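/- **Proposition 3.1.** Let $m_1,m_2$ be nonnegative integers, $m=m_1+m_2$, let $0<\mathbf T<\infty$, and let $v$ be a measurable $m_1\times m_2$ complex matrix function whose entries are square-summable on $(0,\mathbf T)$. Put $$ j=\begin{bmatrix} I_{m_1}&0\\0&-I_{m_2}\end{bmatrix},\qquad V(x)=\begin{bmatrix}0&v(x)\\v(x)^*&0\end{bmatrix}, $$ and let $u(x,z)$ be the fundamental solution on $[0,\mathbf T]$ of the Dirac system $\frac{d}{dx}u(x,z)=\mathrm i\,(zj+jV(x))u(x,z)$ normalized by $u(0,z)=I_m$, that is, the absolutely continuous $m\times m$ matrix function of $x$ which satisfies the system for almost every $x$ and equals $I_m$ at $x=0$. Put $\gamma(x)=\begin{bmatrix}0&I_{m_2}\end{bmatrix}u(x,0)$, let $\gamma_2$ be the right $m_2\times m_2$ block of $\gamma$, and define bounded operators $K$ and $A$ on $L^2_{m_2}(0,\mathbf T)$ (the space of square-summable $\mathbb C^{m_2}$-valued functions) by $$ (Kf)(x)=\mathrm i\int_0^x\gamma(x)\,j\,\gamma(t)^*f(t)\,dt,\qquad (Af)(x)=-\mathrm i\int_0^x f(t)\,dt.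 $$ Then there is a bounded operator $E$ on $L^2_{m_2}(0,\mathbf T)$ with bounded inverse such that: 1. $K=EAE^{-1}$; 2. $(Ef)(x)=f(x)+\int_0^xN(x,t)f(t)\,dt$, where $N$ is a Hilbert–Schmidt kernel, that is, the entries of the $m_2\times m_2$ matrix function $N(x,t)$ are measurable and square-summable on the triangle $0<t\le x\le\mathbf T$; 3. $E^{-1}\gamma_2\equiv I_{m_2}$, where $E^{-1}$ is applied columnwise; 4. both $E$ and $E^{-1}$ map functions with a square-summable derivative (functions which are absolutely continuous on $[0,\mathbf T]$ and whose almost everywhere existing derivative belongs to $L^2_{m_2}(0,\mathbf T)$) into functions with a square-summable derivative. -/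

import Mathlib

open MeasureTheory Set
open scoped Matrix ENNReal

noncomputable section

namespace DiracSim

/-! ### The space `L²_r(0, T)` and integral operators on it -/

/-- Lebesgue measure on the interval `(0, T)` (the endpoint `T` is a null set). -/
abbrev intervalMeasure (T : ℝ) : Measure ℝ := volume.restrict (Ioc 0 T)

/-- The Hilbert space `L²_r(0, T)` of `ℂ^r`-valued square-summable functions on `(0, T)`. -/
abbrev L2 (r : ℕ) (T : ℝ) : Type := Lp (EuclideanSpace ℂ (Fin r)) 2 (intervalMeasure T)

/-- The triangle `0 < t ≤ x ≤ T` of pairs `(x, t)`. -/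
def triangle (T : ℝ) : Set (ℝ × ℝ) := {p | 0 < p.2 ∧ p.2 ≤ p.1 ∧ p.1 ≤ T}

/-- `k(x, t)` is a Hilbert–Schmidt kernel of a lower triangular integral operator on `L²_r(0, T)`:
its entries are measurable and square-summable on the triangle `0 < t ≤ x ≤ T`. -/
def IsHilbertSchmidtKernel {r : ℕ} (T : ℝ) (k : ℝ → ℝ → Matrix (Fin r) (Fin r) ℂ) : Prop :=
  ∀ a b, MemLp (fun p : ℝ × ℝ => k p.1 p.2 a b) 2 ((volume : Measure (ℝ × ℝ)).restrict (triangle T))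

/-- The function `x ↦ ∫₀ˣ k(x, t) f(t) dt`. -/
def volterraFun {r : ℕ} (k : ℝ → ℝ → Matrix (Fin r) (Fin r) ℂ)
    (f : ℝ → EuclideanSpace ℂ (Fin r)) (x : ℝ) : EuclideanSpace ℂ (Fin r) :=
  ∫ t in (0 : ℝ)..x, Matrix.toEuclideanCLM (𝕜 := ℂ) (k x t) (f t)

lemma measurableSet_triangle (T : ℝ) : MeasurableSet (triangle T) := by
  unfold triangle
  measurability

/-- The kernel as an operator-valued function, extended by zero outside the triangle. -/
def extKernel {r : ℕ} (T : ℝ) (k : ℝ → ℝ → Matrix (Fin r) (Fin r) ℂ) :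
    ℝ × ℝ → (EuclideanSpace ℂ (Fin r) →L[ℂ] EuclideanSpace ℂ (Fin r)) :=
  fun p => Matrix.toEuclideanCLM (𝕜 := ℂ) ((triangle T).indicator (fun q => k q.1 q.2) p)

lemma memLp_linearMap_of_entries {α W : Type*} [MeasurableSpace α] {μ : Measure α}
    [NormedAddCommGroup W] [NormedSpace ℂ W] {r : ℕ} (f : α → Matrix (Fin r) (Fin r) ℂ)
    (L : Matrix (Fin r) (Fin r) ℂ →ₗ[ℂ] W) (hf : ∀ a b, MemLp (fun x => f x a b) 2 μ) :
    MemLp (fun x => L (f x)) 2 μ := by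
  have : (fun x => L (f x)) = fun x => ∑ a, ∑ b, f x a b • L (Matrix.single a b (1 : ℂ)) := by
    funext x
    conv_lhs => rw [Matrix.matrix_eq_sum_single (f x)]
    simp only [map_sum, ← map_smul, Matrix.smul_single, smul_eq_mul, mul_one]
  rw [this]
  refine memLp_finsetSum _ fun a _ => memLp_finsetSum _ fun b _ => ?_
  exact (ContinuousLinearMap.toSpanSingleton ℂ (L (Matrix.single a b (1 : ℂ)))).comp_memLp' (hf a b)

lemma IsHilbertSchmidtKernel.memLp_extKernel {r : ℕ} {T : ℝ}
    {k : ℝ → ℝ → Matrix (Fin r) (Fin r) ℂ} (hk : IsHilbertSchmidtKernel T k) :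
    MemLp (extKernel T k) 2 ((intervalMeasure T).prod (intervalMeasure T)) := by
  refine memLp_linearMap_of_entries ((triangle T).indicator fun p : ℝ × ℝ => k p.1 p.2)
    (Matrix.toEuclideanCLM (n := Fin r) (𝕜 := ℂ)).toAlgEquiv.toLinearMap fun a b => ?_
  have h : (fun p => (triangle T).indicator (fun p : ℝ × ℝ => k p.1 p.2) p a b) =
      (triangle T).indicator fun p : ℝ × ℝ => k p.1 p.2 a b := by
    funext p
    by_cases hp : p ∈ triangle T <;> simp [hp]
  rw [h, Measure.prod_restrict]
  exact ((memLp_indicator_iff_restrict (measurableSet_triangle T)).2 (hk a b)).mono_measure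
    Measure.restrict_le_self

lemma volterraFun_eq {r : ℕ} {T : ℝ} (k : ℝ → ℝ → Matrix (Fin r) (Fin r) ℂ)
    (f : ℝ → EuclideanSpace ℂ (Fin r)) {x : ℝ} (hx : x ∈ Ioc 0 T) :
    volterraFun k f x = ∫ t, extKernel T k (x, t) (f t) ∂(intervalMeasure T) := by
  have : (fun t => extKernel T k (x, t) (f t)) =
      (Ioc 0 x).indicator fun t => Matrix.toEuclideanCLM (𝕜 := ℂ) (k x t) (f t) := by
    funext t
    by_cases h : t ∈ Ioc 0 x
    · have h' : (x, t) ∈ triangle T := ⟨h.1, h.2, hx.2⟩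
      rw [indicator_of_mem h, extKernel, indicator_of_mem h']
    · have h' : (x, t) ∉ triangle T := fun h' => h ⟨h'.1, h'.2.1⟩
      rw [indicator_of_notMem h, extKernel, indicator_of_notMem h', map_zero]
      rfl
  rw [this, integral_indicator measurableSet_Ioc, Measure.restrict_restrict measurableSet_Ioc,
    inter_eq_left.2 (Ioc_subset_Ioc_right hx.2), volterraFun,
    intervalIntegral.integral_of_le hx.1.le]

lemma aestronglyMeasurable_volterra_integrand {r : ℕ} {T : ℝ}
    {k : ℝ → ℝ → Matrix (Fin r) (Fin r) ℂ} (hk : IsHilbertSchmidtKernel T k) (f : L2 r T) :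
    AEStronglyMeasurable (fun p : ℝ × ℝ => extKernel T k p (f p.2))
      ((intervalMeasure T).prod (intervalMeasure T)) :=
  (ContinuousLinearMap.id ℂ (EuclideanSpace ℂ (Fin r) →L[ℂ] EuclideanSpace ℂ (Fin r))
    ).aestronglyMeasurable_comp₂ hk.memLp_extKernel.1 (Lp.aestronglyMeasurable f).comp_snd

lemma eLpNorm_extKernel {r : ℕ} {T : ℝ}
    {k : ℝ → ℝ → Matrix (Fin r) (Fin r) ℂ} (hk : IsHilbertSchmidtKernel T k) :
    eLpNorm (fun x => eLpNorm (fun t => extKernel T k (x, t)) 2 (intervalMeasure T)) 2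
      (intervalMeasure T) =
    eLpNorm (extKernel T k) 2 ((intervalMeasure T).prod (intervalMeasure T)) := by
  simp only [eLpNorm_eq_lintegral_rpow_enorm_toReal two_ne_zero ENNReal.ofNat_ne_top,
    ENNReal.toReal_ofNat, enorm_eq_self, ← ENNReal.rpow_mul]
  rw [lintegral_prod _ (hk.memLp_extKernel.1.enorm.pow_const _)]
  norm_num

lemma ae_memLp_extKernel {r : ℕ} {T : ℝ}
    {k : ℝ → ℝ → Matrix (Fin r) (Fin r) ℂ} (hk : IsHilbertSchmidtKernel T k) :
    ∀ᵐ x ∂(intervalMeasure T), MemLp (fun t => extKernel T k (x, t)) 2 (intervalMeasure T) := by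
  have hfin : ∫⁻ x, ∫⁻ t, ‖extKernel T k (x, t)‖ₑ ^ (2 : ℝ) ∂(intervalMeasure T)
      ∂(intervalMeasure T) ≠ ∞ := by
    rw [← lintegral_prod (fun p => ‖extKernel T k p‖ₑ ^ (2 : ℝ))
      (hk.memLp_extKernel.1.enorm.pow_const _)]
    have := lintegral_rpow_enorm_lt_top_of_eLpNorm_lt_top two_ne_zero ENNReal.ofNat_ne_top
      hk.memLp_extKernel.2
    simpa using this.ne
  have hm : AEMeasurable (fun x => ∫⁻ t, ‖extKernel T k (x, t)‖ₑ ^ (2 : ℝ) ∂(intervalMeasure T))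
      (intervalMeasure T) :=
    (hk.memLp_extKernel.1.enorm.pow_const _).lintegral_prod_right'
  filter_upwards [hk.memLp_extKernel.1.prodMk_left, ae_lt_top' hm hfin] with x h1 h2
  refine ⟨h1, ?_⟩
  rw [eLpNorm_lt_top_iff_lintegral_rpow_enorm_lt_top two_ne_zero ENNReal.ofNat_ne_top]
  simpa using h2

/-- For almost every `x` the integral defining `volterraFun` converges absolutely. -/
lemma ae_integrable_volterra {r : ℕ} {T : ℝ}
    {k : ℝ → ℝ → Matrix (Fin r) (Fin r) ℂ} (hk : IsHilbertSchmidtKernel T k) (f : L2 r T) :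
    ∀ᵐ x ∂(intervalMeasure T),
      Integrable (fun t => extKernel T k (x, t) (f t)) (intervalMeasure T) := by
  filter_upwards [ae_memLp_extKernel hk,
    (aestronglyMeasurable_volterra_integrand hk f).prodMk_left] with x h1 h2
  rw [← memLp_one_iff_integrable]
  exact MemLp.of_bilin (p := 2) (q := 2) (r := 1) (fun L v => L v) 1 h1 (Lp.memLp f) h2
    (.of_forall fun t => by
      rw [one_mul]; exact (extKernel T k (x, t)).le_opNNNorm (f t))

lemma ae_enorm_volterraFun_le {r : ℕ} {T : ℝ}
    {k : ℝ → ℝ → Matrix (Fin r) (Fin r) ℂ} (hk : IsHilbertSchmidtKernel T k) (f : L2 r T) :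
    ∀ᵐ x ∂(intervalMeasure T), ‖volterraFun k f x‖ₑ ≤
      eLpNorm f 2 (intervalMeasure T) *
        eLpNorm (fun t => extKernel T k (x, t)) 2 (intervalMeasure T) := by
  filter_upwards [ae_memLp_extKernel hk, ae_restrict_mem measurableSet_Ioc] with x h1 hx
  rw [volterraFun_eq k f hx, mul_comm]
  refine (enorm_integral_le_lintegral_enorm _).trans ?_
  rw [← eLpNorm_one_eq_lintegral_enorm]
  have := eLpNorm_le_eLpNorm_mul_eLpNorm_of_nnnorm (p := 2) (q := 2) (r := 1) h1.1
    (Lp.aestronglyMeasurable f) (fun L v => L v) 1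
    (.of_forall fun t => by
      rw [one_mul]; exact (extKernel T k (x, t)).le_opNNNorm (f t))
  simpa using this

lemma aestronglyMeasurable_volterraFun {r : ℕ} {T : ℝ}
    {k : ℝ → ℝ → Matrix (Fin r) (Fin r) ℂ} (hk : IsHilbertSchmidtKernel T k) (f : L2 r T) :
    AEStronglyMeasurable (volterraFun k f) (intervalMeasure T) := by
  refine (aestronglyMeasurable_volterra_integrand hk f).integral_prod_right'.congr ?_
  filter_upwards [ae_restrict_mem measurableSet_Ioc] with x hx
  exact (volterraFun_eq k f hx).symm

lemma eLpNorm_volterraFun_le {r : ℕ} {T : ℝ}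
    {k : ℝ → ℝ → Matrix (Fin r) (Fin r) ℂ} (hk : IsHilbertSchmidtKernel T k) (f : L2 r T) :
    eLpNorm (volterraFun k f) 2 (intervalMeasure T) ≤
      eLpNorm f 2 (intervalMeasure T) *
        eLpNorm (extKernel T k) 2 ((intervalMeasure T).prod (intervalMeasure T)) := by
  have hC : eLpNorm f 2 (intervalMeasure T) ≠ ∞ := (Lp.memLp f).2.ne
  rw [← eLpNorm_extKernel hk]
  have h := eLpNorm_le_nnreal_smul_eLpNorm_of_ae_le_mul'
    (c := (eLpNorm f 2 (intervalMeasure T)).toNNReal) (μ := intervalMeasure T)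
    (f := volterraFun k f)
    (g := fun x => eLpNorm (fun t => extKernel T k (x, t)) 2 (intervalMeasure T))
    (by simpa [ENNReal.coe_toNNReal hC] using ae_enorm_volterraFun_le hk f) 2
  simpa [ENNReal.smul_def, ENNReal.coe_toNNReal hC] using h

lemma memLp_volterraFun {r : ℕ} {T : ℝ}
    {k : ℝ → ℝ → Matrix (Fin r) (Fin r) ℂ} (hk : IsHilbertSchmidtKernel T k) (f : L2 r T) :
    MemLp (volterraFun k f) 2 (intervalMeasure T) :=
  ⟨aestronglyMeasurable_volterraFun hk f, (eLpNorm_volterraFun_le hk f).trans_lt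
    (ENNReal.mul_lt_top (Lp.memLp f).2 hk.memLp_extKernel.2)⟩

/-- The bounded operator `(B f)(x) = ∫₀ˣ k(x, t) f(t) dt` on `L²_r(0, T)` with a Hilbert–Schmidt
kernel `k`. -/
def volterraOp {r : ℕ} {T : ℝ} (k : ℝ → ℝ → Matrix (Fin r) (Fin r) ℂ)
    (hk : IsHilbertSchmidtKernel T k) : L2 r T →L[ℂ] L2 r T :=
  LinearMap.mkContinuous
    { toFun := fun f => (memLp_volterraFun hk f).toLp (volterraFun k f)
      map_add' := by
        intro f g
        rw [← MemLp.toLp_add]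
        refine (MemLp.toLp_eq_toLp_iff _ _).2 ?_
        filter_upwards [ae_integrable_volterra hk f, ae_integrable_volterra hk g,
          ae_restrict_mem measurableSet_Ioc] with x hf hg hx
        rw [Pi.add_apply, volterraFun_eq k _ hx, volterraFun_eq k _ hx, volterraFun_eq k _ hx,
          ← integral_add hf hg]
        refine integral_congr_ae ?_
        filter_upwards [Lp.coeFn_add f g] with t ht
        rw [ht, Pi.add_apply, map_add]
      map_smul' := by
        intro c f
        rw [RingHom.id_apply, ← MemLp.toLp_const_smul]
        refine (MemLp.toLp_eq_toLp_iff _ _).2 ?_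
        filter_upwards [ae_restrict_mem measurableSet_Ioc] with x hx
        rw [Pi.smul_apply, volterraFun_eq k _ hx, volterraFun_eq k _ hx, ← integral_smul]
        refine integral_congr_ae ?_
        filter_upwards [Lp.coeFn_smul c f] with t ht
        rw [ht, Pi.smul_apply, map_smul] }
    (eLpNorm (extKernel T k) 2 ((intervalMeasure T).prod (intervalMeasure T))).toReal
    (by
      intro f
      simp only [LinearMap.coe_mk, AddHom.coe_mk]
      rw [Lp.norm_toLp, Lp.norm_def, mul_comm, ← ENNReal.toReal_mul]
      exact ENNReal.toReal_mono
        (ENNReal.mul_ne_top (Lp.memLp f).2.ne hk.memLp_extKernel.2.ne)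
        (eLpNorm_volterraFun_le hk f))

lemma coeFn_volterraOp {r : ℕ} {T : ℝ} (k : ℝ → ℝ → Matrix (Fin r) (Fin r) ℂ)
    (hk : IsHilbertSchmidtKernel T k) (f : L2 r T) :
    volterraOp k hk f =ᵐ[intervalMeasure T] volterraFun k f :=
  MemLp.coeFn_toLp (memLp_volterraFun hk f)

/-- A kernel that is continuous on the square `[0, T]²` is Hilbert–Schmidt. -/
lemma isHilbertSchmidtKernel_of_continuousOn {r : ℕ} {T : ℝ}
    {k : ℝ → ℝ → Matrix (Fin r) (Fin r) ℂ}
    (hk : ∀ a b, ContinuousOn (fun p : ℝ × ℝ => k p.1 p.2 a b) (Icc 0 T ×ˢ Icc 0 T)) :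
    IsHilbertSchmidtKernel T k := by
  intro a b
  have hc : IsCompact (Icc (0 : ℝ) T ×ˢ Icc (0 : ℝ) T) := isCompact_Icc.prod isCompact_Icc
  obtain ⟨C, hC⟩ := hc.exists_bound_of_continuousOn (hk a b)
  have : IsFiniteMeasure ((volume : Measure (ℝ × ℝ)).restrict (Icc (0 : ℝ) T ×ˢ Icc (0 : ℝ) T)) :=
    ⟨by simpa using hc.measure_lt_top⟩
  have h : MemLp (fun p : ℝ × ℝ => k p.1 p.2 a b) 2
      ((volume : Measure (ℝ × ℝ)).restrict (Icc (0 : ℝ) T ×ˢ Icc (0 : ℝ) T)) := by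
    refine MemLp.of_bound ((hk a b).aestronglyMeasurable hc.measurableSet) C ?_
    filter_upwards [ae_restrict_mem hc.measurableSet] with p hp using hC p hp
  refine h.mono_measure (Measure.restrict_mono ?_ le_rfl)
  rintro ⟨x, t⟩ ⟨h1, h2, h3⟩
  simp only [mem_prod, mem_Icc] at *
  exact ⟨⟨by linarith, h3⟩, by linarith, by linarith⟩

/-- The operator `A = -i ∫₀ˣ · dt` on `L²_r(0, T)`. -/
def integrationOp (r : ℕ) (T : ℝ) : L2 r T →L[ℂ] L2 r T :=
  volterraOp (fun _ _ => (-Complex.I) • (1 : Matrix (Fin r) (Fin r) ℂ))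
    (isHilbertSchmidtKernel_of_continuousOn fun _ _ => continuousOn_const)

/-- The class `F ∈ L²_r(0, T)` contains a function that is absolutely continuous on `[0, T]` and
whose (almost everywhere existing) derivative is square-summable on `(0, T)`. -/
def HasSquareSummableDeriv {r : ℕ} {T : ℝ} (F : L2 r T) : Prop :=
  ∃ f f' : ℝ → EuclideanSpace ℂ (Fin r),
    F =ᵐ[intervalMeasure T] f ∧ AbsolutelyContinuousOnInterval f 0 T ∧
      MemLp f' 2 (intervalMeasure T) ∧ ∀ᵐ x ∂(intervalMeasure T), HasDerivAt f (f' x) x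

/-! ### The Dirac system -/

/-- The signature matrix `j = diag(I_{m₁}, -I_{m₂})`. -/
def signature (m₁ m₂ : ℕ) : Matrix (Fin m₁ ⊕ Fin m₂) (Fin m₁ ⊕ Fin m₂) ℂ :=
  Matrix.fromBlocks 1 0 0 (-1)

/-- The matrix function `V = [[0, v], [v*, 0]]`. -/
def fullPotential {m₁ m₂ : ℕ} (v : ℝ → Matrix (Fin m₁) (Fin m₂) ℂ) (x : ℝ) :
    Matrix (Fin m₁ ⊕ Fin m₂) (Fin m₁ ⊕ Fin m₂) ℂ :=
  Matrix.fromBlocks 0 (v x) (v x)ᴴ 0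

/-- The potential `v` is (measurable and) square-summable on `(0, T)`, entrywise. -/
def SquareSummable {m₁ m₂ : ℕ} (T : ℝ) (v : ℝ → Matrix (Fin m₁) (Fin m₂) ℂ) : Prop :=
  ∀ a b, MemLp (fun x => v x a b) 2 (intervalMeasure T)

/-- `w` is the fundamental solution on `[0, T]` of the Dirac system
`y'(x, z) = i (z j + j V(x)) y(x, z)` for the value `z` of the spectral parameter, normalized by
`w(0) = I_m`: `w` is absolutely continuous and satisfies the system almost everywhere. -/
structure IsFundamentalSolution {m₁ m₂ : ℕ} (T : ℝ) (v : ℝ → Matrix (Fin m₁) (Fin m₂) ℂ) (z : ℂ)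
    (w : ℝ → Matrix (Fin m₁ ⊕ Fin m₂) (Fin m₁ ⊕ Fin m₂) ℂ) : Prop where
  absolutelyContinuous : ∀ a b, AbsolutelyContinuousOnInterval (fun x => w x a b) 0 T
  hasDerivAt : ∀ᵐ x ∂(intervalMeasure T), ∀ a b, HasDerivAt (fun s => w s a b)
    ((Complex.I • ((z • signature m₁ m₂ + signature m₁ m₂ * fullPotential v x) * w x)) a b) x
  initial : w 0 = 1

/-- The lower block row `γ(x) = [0  I_{m₂}] u(x)`. -/
def lowerBlockRow {m₁ m₂ : ℕ} (u : ℝ → Matrix (Fin m₁ ⊕ Fin m₂) (Fin m₁ ⊕ Fin m₂) ℂ) (x : ℝ) :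
    Matrix (Fin m₂) (Fin m₁ ⊕ Fin m₂) ℂ :=
  Matrix.fromCols (0 : Matrix (Fin m₂) (Fin m₁) ℂ) (1 : Matrix (Fin m₂) (Fin m₂) ℂ) * u x

/-- The right `m₂ × m₂` block `γ₂` of `γ`. -/
def gammaTwo {m₁ m₂ : ℕ} (u : ℝ → Matrix (Fin m₁ ⊕ Fin m₂) (Fin m₁ ⊕ Fin m₂) ℂ) (x : ℝ) :
    Matrix (Fin m₂) (Fin m₂) ℂ :=
  (lowerBlockRow u x).toCols₂

lemma lowerBlockRow_apply {m₁ m₂ : ℕ} (u : ℝ → Matrix (Fin m₁ ⊕ Fin m₂) (Fin m₁ ⊕ Fin m₂) ℂ)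
    (x : ℝ) (a : Fin m₂) (b : Fin m₁ ⊕ Fin m₂) :
    lowerBlockRow u x a b = u x (Sum.inr a) b := by
  simp [lowerBlockRow, Matrix.mul_apply, Matrix.one_apply]

lemma IsFundamentalSolution.continuousOn_lowerBlockRow {m₁ m₂ : ℕ} {T : ℝ} (hT : 0 < T)
    {v : ℝ → Matrix (Fin m₁) (Fin m₂) ℂ} {z : ℂ}
    {u : ℝ → Matrix (Fin m₁ ⊕ Fin m₂) (Fin m₁ ⊕ Fin m₂) ℂ}
    (hu : IsFundamentalSolution T v z u) (a : Fin m₂) (b : Fin m₁ ⊕ Fin m₂) :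
    ContinuousOn (fun x => lowerBlockRow u x a b) (Icc 0 T) := by
  simp only [lowerBlockRow_apply]
  have := (hu.absolutelyContinuous (Sum.inr a) b).continuousOn
  rwa [uIcc_of_le hT.le] at this

/-- The kernel `i γ(x) j γ(t)*` of the operator `K`. -/
def diracKernel {m₁ m₂ : ℕ} (u : ℝ → Matrix (Fin m₁ ⊕ Fin m₂) (Fin m₁ ⊕ Fin m₂) ℂ) (x t : ℝ) :
    Matrix (Fin m₂) (Fin m₂) ℂ :=
  Complex.I • (lowerBlockRow u x * signature m₁ m₂ * (lowerBlockRow u t)ᴴ)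

lemma IsFundamentalSolution.isHilbertSchmidtKernel {m₁ m₂ : ℕ} {T : ℝ} (hT : 0 < T)
    {v : ℝ → Matrix (Fin m₁) (Fin m₂) ℂ} {z : ℂ}
    {u : ℝ → Matrix (Fin m₁ ⊕ Fin m₂) (Fin m₁ ⊕ Fin m₂) ℂ}
    (hu : IsFundamentalSolution T v z u) : IsHilbertSchmidtKernel T (diracKernel u) := by
  refine isHilbertSchmidtKernel_of_continuousOn fun a b => ?_
  have hx : ∀ a b, ContinuousOn (fun p : ℝ × ℝ => lowerBlockRow u p.1 a b)
      (Icc 0 T ×ˢ Icc 0 T) := fun a b =>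
    (hu.continuousOn_lowerBlockRow hT a b).comp continuousOn_fst fun p hp => hp.1
  have ht : ∀ a b, ContinuousOn (fun p : ℝ × ℝ => lowerBlockRow u p.2 a b)
      (Icc 0 T ×ˢ Icc 0 T) := fun a b =>
    (hu.continuousOn_lowerBlockRow hT a b).comp continuousOn_snd fun p hp => hp.2
  simp only [diracKernel, Matrix.smul_apply, Matrix.mul_apply, Matrix.conjTranspose_apply,
    smul_eq_mul]
  refine continuousOn_const.mul (continuousOn_finsetSum _ fun c _ => ?_)
  refine (continuousOn_finsetSum _ fun d _ => (hx a d).mul continuousOn_const).mul ?_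
  exact continuous_star.comp_continuousOn (ht b c)

/-- The operator `K = i ∫₀ˣ γ(x) j γ(t)* · dt` on `L²_{m₂}(0, T)`. -/
def diracOp {m₁ m₂ : ℕ} {T : ℝ} (hT : 0 < T) {v : ℝ → Matrix (Fin m₁) (Fin m₂) ℂ}
    {u : ℝ → Matrix (Fin m₁ ⊕ Fin m₂) (Fin m₁ ⊕ Fin m₂) ℂ}
    (hu : IsFundamentalSolution T v 0 u) : L2 m₂ T →L[ℂ] L2 m₂ T :=
  volterraOp (diracKernel u) (hu.isHilbertSchmidtKernel hT)

/-- The function `x ↦ γ₂(x) c`, for a vector `c ∈ ℂ^{m₂}`. -/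
def gammaTwoVec {m₁ m₂ : ℕ} (u : ℝ → Matrix (Fin m₁ ⊕ Fin m₂) (Fin m₁ ⊕ Fin m₂) ℂ)
    (c : EuclideanSpace ℂ (Fin m₂)) (x : ℝ) : EuclideanSpace ℂ (Fin m₂) :=
  Matrix.toEuclideanCLM (𝕜 := ℂ) (gammaTwo u x) c

lemma IsFundamentalSolution.memLp_gammaTwoVec {m₁ m₂ : ℕ} {T : ℝ} (hT : 0 < T)
    {v : ℝ → Matrix (Fin m₁) (Fin m₂) ℂ} {z : ℂ}
    {u : ℝ → Matrix (Fin m₁ ⊕ Fin m₂) (Fin m₁ ⊕ Fin m₂) ℂ}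
    (hu : IsFundamentalSolution T v z u) (c : EuclideanSpace ℂ (Fin m₂)) :
    MemLp (gammaTwoVec u c) 2 (intervalMeasure T) := by
  have hc : ContinuousOn (gammaTwoVec u c) (Icc 0 T) := by
    refine (PiLp.continuous_toLp 2 _).comp_continuousOn
      (f := fun x => gammaTwo u x *ᵥ c.ofLp) (continuousOn_pi.2 fun a => ?_)
    simp only [Matrix.mulVec, dotProduct]
    exact continuousOn_finsetSum _ fun b _ =>
      (hu.continuousOn_lowerBlockRow hT a (Sum.inr b)).mul continuousOn_const
  obtain ⟨C, hC⟩ := isCompact_Icc.exists_bound_of_continuousOn hc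
  refine MemLp.of_bound ((hc.mono Ioc_subset_Icc_self).aestronglyMeasurable measurableSet_Ioc) C ?_
  filter_upwards [ae_restrict_mem measurableSet_Ioc] with x hx
  exact hC x (Ioc_subset_Icc_self hx)

end DiracSim

end

noncomputable section

namespace DiracSim

/-! ### Absolutely continuous functions -/

section AbsolutelyContinuous

variable {F : Type*} [NormedAddCommGroup F] {a b : ℝ}

/-! The system at `z = 0` reads `u' = i j V u`, and `V* = V` makes `u` unitary for the form `j`: `u
j u* = j`. Let `Q` be the operator with kernel `v(x)* v(t)` on the triangle. Solving the system with
a source in the lower block and using `u j u* = j` gives `A = K (1 - i Q A)`; formally `K⁻¹ = A⁻¹ -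
i Q`. Thus `K` is similar to `A` as soon as an invertible `E` satisfies `E A = A (E + i Q E A)`,
because then `(1 - i Q A)(E + i Q E A) = E` and hence `E A = K E`.

Seek `E = 1 + κ` with a triangular kernel. The required relation is formally `(∂ₓ + ∂ₜ) κ = M` with
`κ(x, 0) = 0`, where `M = q + q κ` is the kernel of `Q E`. In integrated form, `κ(x, t)` is the
integral of `M` along the diagonal line below `(x, t)`. No derivative of `v` enters, so
square-summability suffices. This fixed-point equation is solved by iteration in a norm weighted by
`exp (c t)` (`exists_eq_transformStep`). Its solution is bounded, so the powers of its operator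
decay factorially and `E` is invertible (`isUnit_one_add_op`). A change of variables along diagonals
turns the equation into the commutation relation (`integral_diagonalIntegral_sub`,
`op_comp_integrationOp_sub`).

The condition `κ(x, 0) = 0` gives `E c = c + i A Q E c` for constants `c`. The columns of `γ₂`
satisfy the same equation (`gammaTwoVec_eq`), whose solution is unique, so `E c = γ₂ c`. Finally,
functions with a square-summable derivative are exactly constants plus the range of `A`, and the
relations above show that `E` and `E⁻¹` preserve this space. -/

lemma absolutelyContinuousOnInterval_of_dist_le {f : ℝ → F} {g : ℝ → ℝ}
    (hg : AbsolutelyContinuousOnInterval g a b)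
    (h : ∀ x ∈ uIcc a b, ∀ y ∈ uIcc a b, dist (f x) (f y) ≤ dist (g x) (g y)) :
    AbsolutelyContinuousOnInterval f a b := by
  rw [absolutelyContinuousOnInterval_iff] at hg ⊢
  intro ε hε
  obtain ⟨δ, hδ, H⟩ := hg ε hε
  refine ⟨δ, hδ, fun I hI hI' => (Finset.sum_le_sum fun i hi => ?_).trans_lt (H I hI hI')⟩
  have := hI.1 i hi
  exact h _ this.1 _ this.2

lemma absolutelyContinuousOnInterval_const (c : F) :
    AbsolutelyContinuousOnInterval (fun _ : ℝ => c) a b :=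
  (LipschitzWith.const c).lipschitzOnWith.absolutelyContinuousOnInterval

lemma absolutelyContinuousOnInterval_sum {ι : Type*} (s : Finset ι) {f : ι → ℝ → F}
    (hf : ∀ i ∈ s, AbsolutelyContinuousOnInterval (f i) a b) :
    AbsolutelyContinuousOnInterval (fun x => ∑ i ∈ s, f i x) a b := by
  classical
  induction s using Finset.induction_on with
  | empty => simpa using absolutelyContinuousOnInterval_const (0 : F)
  | insert i s hi ih =>
    simp only [Finset.sum_insert hi]
    exact (hf i (Finset.mem_insert_self i s)).fun_add
      (ih fun j hj => hf j (Finset.mem_insert_of_mem hj))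

lemma absolutelyContinuousOnInterval_star {f : ℝ → ℂ}
    (hf : AbsolutelyContinuousOnInterval f a b) :
    AbsolutelyContinuousOnInterval (fun x => star (f x)) a b := by
  rw [absolutelyContinuousOnInterval_iff] at hf ⊢
  intro ε hε
  obtain ⟨δ, hδ, H⟩ := hf ε hε
  refine ⟨δ, hδ, fun I hI hI' => (Finset.sum_le_sum fun i hi => ?_).trans_lt (H I hI hI')⟩
  rw [dist_eq_norm, dist_eq_norm, ← star_sub, norm_star]

variable [NormedSpace ℝ F]

/-- The increments are dominated by those of the real function `∫ ‖f‖`, which reduces the claim to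
the scalar case. -/
lemma absolutelyContinuousOnInterval_integral {f : ℝ → F}
    (hf : IntervalIntegrable f volume a b) :
    AbsolutelyContinuousOnInterval (fun x => ∫ t in a..x, f t) a b := by
  refine absolutelyContinuousOnInterval_of_dist_le
    (hf.norm.absolutelyContinuousOnInterval_intervalIntegral (c := a) left_mem_uIcc)
    fun x hx y hy => ?_
  have hx' : IntervalIntegrable f volume a x := hf.mono_set (uIcc_subset_uIcc_left hx)
  have hy' : IntervalIntegrable f volume a y := hf.mono_set (uIcc_subset_uIcc_left hy)
  rw [dist_eq_norm, dist_eq_norm, intervalIntegral.integral_interval_sub_left hx' hy',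
    intervalIntegral.integral_interval_sub_left hx'.norm hy'.norm]
  exact intervalIntegral.norm_integral_le_abs_integral_norm

lemma ae_hasDerivAt_integral [CompleteSpace F] (hab : a ≤ b) {f : ℝ → F}
    (hf : IntervalIntegrable f volume a b) :
    ∀ᵐ x ∂(volume.restrict (Ioc a b)), HasDerivAt (fun x => ∫ t in a..x, f t) (f x) x := by
  rw [ae_restrict_iff' measurableSet_Ioc]
  filter_upwards [hf.ae_hasDerivAt_integral] with x hx hxm
  rw [uIcc_of_le hab] at hx
  exact hx (Ioc_subset_Icc_self hxm) a (left_mem_Icc.2 hab)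

/-- The fundamental theorem of calculus for absolutely continuous functions with values in a
Banach space. -/
lemma eq_add_integral_of_absolutelyContinuous [CompleteSpace F] (hab : a ≤ b) {f f' : ℝ → F}
    (hf : AbsolutelyContinuousOnInterval f a b)
    (hd : ∀ᵐ x ∂(volume.restrict (Ioc a b)), HasDerivAt f (f' x) x)
    (hf' : IntervalIntegrable f' volume a b) {x : ℝ} (hx : x ∈ Icc a b) :
    f x = f a + ∫ t in a..x, f' t := by
  have hz : ∀ᵐ x, x ∈ uIcc a b → HasDerivAt (fun x => f x - ∫ t in a..x, f' t) 0 x := by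
    -- The derivatives are known almost everywhere on `Ioc a b`, while the constancy criterion
    -- speaks of the closed interval; the left endpoint is a null set.
    have hne : ∀ᵐ x : ℝ, x ≠ a := by simp [ae_iff, measure_singleton]
    filter_upwards [(ae_restrict_iff' measurableSet_Ioc).1 hd,
      (ae_restrict_iff' measurableSet_Ioc).1 (ae_hasDerivAt_integral hab hf'), hne]
      with y h1 h2 h3 hy
    rw [uIcc_of_le hab] at hy
    have hy' : y ∈ Ioc a b := ⟨lt_of_le_of_ne hy.1 (Ne.symm h3), hy.2⟩
    simpa using (h1 hy').fun_sub (h2 hy')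
  obtain ⟨C, hC⟩ :=
    (hf.fun_sub (absolutelyContinuousOnInterval_integral hf')).const_of_ae_hasDerivAt_zero hz
  have h1 := hC x (by rwa [uIcc_of_le hab])
  have h2 := hC a left_mem_uIcc
  simp only [intervalIntegral.integral_same, sub_zero] at h2
  rw [h2, ← h1]
  abel

end AbsolutelyContinuous

/-! ### Functions with a square-summable derivative -/

lemma intervalIntegrable_of_memLp {r : ℕ} {T : ℝ} (hT : 0 ≤ T)
    {f : ℝ → EuclideanSpace ℂ (Fin r)} (hf : MemLp f 2 (intervalMeasure T)) :
    IntervalIntegrable f volume 0 T := by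
  rw [intervalIntegrable_iff_integrableOn_Ioc_of_le hT]
  exact hf.integrable (by norm_num)

lemma coeFn_integrationOp {r : ℕ} {T : ℝ} (f : L2 r T) :
    integrationOp r T f =ᵐ[intervalMeasure T] fun x => -Complex.I • ∫ t in (0 : ℝ)..x, f t := by
  refine (coeFn_volterraOp _ _ f).trans (.of_eq ?_)
  funext x
  simp only [volterraFun, map_smul, map_one, smul_apply, one_apply_eq_self]
  exact intervalIntegral.integral_smul _ _

lemma hasSquareSummableDeriv_const_add {r : ℕ} {T : ℝ} (hT : 0 < T)
    (c : EuclideanSpace ℂ (Fin r)) (g : L2 r T) :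
    HasSquareSummableDeriv (Lp.const 2 (intervalMeasure T) c + integrationOp r T g) := by
  have hg := intervalIntegrable_of_memLp hT.le (Lp.memLp g)
  refine ⟨fun x => c + -Complex.I • ∫ t in (0 : ℝ)..x, g t, fun x => -Complex.I • g x, ?_, ?_,
    ((Lp.memLp g).const_smul (-Complex.I) :), ?_⟩
  · filter_upwards [Lp.coeFn_add (Lp.const 2 (intervalMeasure T) c) (integrationOp r T g),
      coeFn_integrationOp g, Lp.coeFn_const (μ := intervalMeasure T) (p := 2) c] with x h1 h2 h3
    rw [h1, Pi.add_apply, h2, h3, Function.const_apply]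
  · exact (absolutelyContinuousOnInterval_const c).fun_add
      ((absolutelyContinuousOnInterval_integral hg).const_smul (-Complex.I))
  · filter_upwards [ae_hasDerivAt_integral hT.le hg] with x hx
    exact (hx.const_smul (-Complex.I)).const_add c

/-- Since `A (i f') = ∫ f'`, the fundamental theorem of calculus gives `f = f 0 + A (i f')`.
Together with the converse above, preservation of the class becomes an algebraic question about
operators and `A`. -/
lemma HasSquareSummableDeriv.exists_eq_const_add {r : ℕ} {T : ℝ} (hT : 0 < T) {F : L2 r T}
    (hF : HasSquareSummableDeriv F) :
    ∃ c g, F = Lp.const 2 (intervalMeasure T) c + integrationOp r T g := by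
  obtain ⟨f, f', hFf, hac, hf', hd⟩ := hF
  refine ⟨f 0, Complex.I • hf'.toLp f', ?_⟩
  have hi := intervalIntegrable_of_memLp hT.le hf'
  ext1
  filter_upwards [Lp.coeFn_add (Lp.const 2 (intervalMeasure T) (f 0))
      (integrationOp r T (Complex.I • hf'.toLp f')), hFf,
    coeFn_integrationOp (hf'.toLp f'), Lp.coeFn_const (μ := intervalMeasure T) (p := 2) (f 0),
    Lp.coeFn_smul Complex.I (integrationOp r T (hf'.toLp f')),
    ae_restrict_mem measurableSet_Ioc] with x h1 h2 h3 h4 h5 hx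
  rw [h1, Pi.add_apply, map_smul, h5, Pi.smul_apply, h3, h4, h2, Function.const_apply, smul_smul,
    eq_add_integral_of_absolutelyContinuous hT.le hac hd hi (Ioc_subset_Icc_self hx)]
  simp only [mul_neg, Complex.I_mul_I, neg_neg, one_smul]
  congr 1
  refine intervalIntegral.integral_congr_ae ?_
  have h6 := (ae_restrict_iff' measurableSet_Ioc).1 hf'.coeFn_toLp
  filter_upwards [h6] with t ht htm
  rw [uIoc_of_le hx.1.le] at htm
  exact (ht ⟨htm.1, htm.2.trans hx.2⟩).symm

/-! ### Operators with dominated triangular kernels -/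

/-- The algebra of operators on `ℂ^r`. -/
abbrev Op (r : ℕ) : Type := EuclideanSpace ℂ (Fin r) →L[ℂ] EuclideanSpace ℂ (Fin r)

/-- A square-integrable weight which is at least one on `(0, T]` and zero elsewhere. -/
structure IsWeight (T : ℝ) (ω : ℝ → ℝ) : Prop where
  measurable : Measurable ω
  one_le : ∀ x ∈ Ioc 0 T, 1 ≤ ω x
  eq_zero : ∀ x ∉ Ioc 0 T, ω x = 0
  memLp : MemLp ω 2 volume

/-- A measurable kernel which vanishes off the triangle `0 < t ≤ x ≤ T` and is dominated by a
multiple of `ω(x) ω(t)`. -/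
structure IsDominatedKernel {r : ℕ} (T : ℝ) (ω : ℝ → ℝ) (κ : ℝ × ℝ → Op r) : Prop where
  stronglyMeasurable : StronglyMeasurable κ
  eq_zero : ∀ p ∉ triangle T, κ p = 0
  bound : ∃ C, 0 ≤ C ∧ ∀ p, ‖κ p‖ ≤ C * (ω p.1 * ω p.2)

/-- The kernel of a product of two integral operators. -/
def kernelComp {r : ℕ} (κ ℓ : ℝ × ℝ → Op r) (p : ℝ × ℝ) : Op r :=
  ∫ s, κ (p.1, s) * ℓ (s, p.2)

/-- A kernel with values in operators on `ℂ^r`, as a matrix kernel. -/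
def matrixKernel {r : ℕ} (κ : ℝ × ℝ → Op r) (x t : ℝ) : Matrix (Fin r) (Fin r) ℂ :=
  (Matrix.toEuclideanCLM (n := Fin r) (𝕜 := ℂ)).symm (κ (x, t))

variable {r : ℕ} {T : ℝ} {ω : ℝ → ℝ} {κ ℓ : ℝ × ℝ → Op r}

namespace IsWeight

lemma nonneg (hω : IsWeight T ω) (x : ℝ) : 0 ≤ ω x := by
  by_cases hx : x ∈ Ioc 0 T
  · exact zero_le_one.trans (hω.one_le x hx)
  · exact (hω.eq_zero x hx).ge

lemma le_sq (hω : IsWeight T ω) (x : ℝ) : ω x ≤ ω x ^ 2 := by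
  by_cases hx : x ∈ Ioc 0 T
  · nlinarith [hω.one_le x hx]
  · simp [hω.eq_zero x hx]

lemma integrable_sq (hω : IsWeight T ω) : Integrable fun x => ω x ^ 2 := hω.memLp.integrable_sq

lemma integrable (hω : IsWeight T ω) : Integrable ω :=
  hω.integrable_sq.mono' hω.measurable.aestronglyMeasurable <| .of_forall fun x => by
    rw [Real.norm_of_nonneg (hω.nonneg x)]
    exact hω.le_sq x

end IsWeight

lemma extKernel_matrixKernel (hκ : ∀ p ∉ triangle T, κ p = 0) :
    extKernel T (matrixKernel κ) = κ := by
  funext p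
  by_cases hp : p ∈ triangle T
  · rw [extKernel, indicator_of_mem hp]
    exact StarAlgEquiv.apply_symm_apply _ _
  · rw [extKernel, indicator_of_notMem hp, map_zero, hκ p hp]

namespace IsDominatedKernel

lemma memLp (hω : IsWeight T ω) (hκ : IsDominatedKernel T ω κ) : MemLp κ 2 volume := by
  obtain ⟨C, hC, hb⟩ := hκ.bound
  have h : MemLp (fun p : ℝ × ℝ => C * (ω p.1 * ω p.2)) 2 volume := by
    refine MemLp.const_mul ?_ C
    have hm : Measurable fun p : ℝ × ℝ => ω p.1 * ω p.2 :=
      (hω.measurable.comp measurable_fst).mul (hω.measurable.comp measurable_snd)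
    rw [memLp_two_iff_integrable_sq hm.aestronglyMeasurable]
    simp only [mul_pow]
    exact hω.integrable_sq.mul_prod hω.integrable_sq
  exact h.mono' hκ.stronglyMeasurable.aestronglyMeasurable (.of_forall hb)

lemma integrable (hω : IsWeight T ω) (hκ : IsDominatedKernel T ω κ) : Integrable κ := by
  obtain ⟨C, hC, hb⟩ := hκ.bound
  exact ((hω.integrable.mul_prod hω.integrable).const_mul C).mono'
    hκ.stronglyMeasurable.aestronglyMeasurable (.of_forall hb)

lemma isHilbertSchmidtKernel (hω : IsWeight T ω) (hκ : IsDominatedKernel T ω κ) :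
    IsHilbertSchmidtKernel T (matrixKernel κ) := by
  intro a b
  let L : Op r →ₗ[ℂ] ℂ := Matrix.entryLinearMap ℂ ℂ a b ∘ₗ
    (Matrix.toEuclideanCLM (n := Fin r) (𝕜 := ℂ)).symm.toAlgEquiv.toLinearMap
  exact (L.toContinuousLinearMap.comp_memLp' (hκ.memLp hω)).restrict _

/-- The operator with the kernel `κ`. -/
def op (hω : IsWeight T ω) (hκ : IsDominatedKernel T ω κ) : L2 r T →L[ℂ] L2 r T :=
  volterraOp (matrixKernel κ) (hκ.isHilbertSchmidtKernel hω)

lemma coeFn_op (hω : IsWeight T ω) (hκ : IsDominatedKernel T ω κ) (f : L2 r T) :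
    hκ.op hω f =ᵐ[intervalMeasure T] fun x => ∫ t, κ (x, t) (f t) ∂(intervalMeasure T) := by
  filter_upwards [coeFn_volterraOp _ (hκ.isHilbertSchmidtKernel hω) f,
    ae_restrict_mem measurableSet_Ioc] with x h1 hx
  rw [op, h1, volterraFun_eq _ _ hx, extKernel_matrixKernel hκ.eq_zero]

lemma integrable_apply (hω : IsWeight T ω) (hκ : IsDominatedKernel T ω κ) (f : L2 r T) (x : ℝ) :
    Integrable (fun t => κ (x, t) (f t)) (intervalMeasure T) := by
  obtain ⟨C, hC, hb⟩ := hκ.bound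
  have h1 : MemLp (fun t => κ (x, t)) 2 (intervalMeasure T) := by
    refine MemLp.mono' ((hω.memLp.restrict _).const_mul (C * ω x))
      (hκ.stronglyMeasurable.comp_measurable measurable_prodMk_left).aestronglyMeasurable
      (.of_forall fun t => ?_)
    rw [mul_assoc]
    exact hb (x, t)
  rw [← memLp_one_iff_integrable]
  exact MemLp.of_bilin (p := 2) (q := 2) (r := 1) (fun L v => L v) 1 h1 (Lp.memLp f)
    ((ContinuousLinearMap.id ℂ (Op r)).aestronglyMeasurable_comp₂ h1.1 (Lp.memLp f).1)
    (.of_forall fun t => by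
      rw [one_mul]; exact (κ (x, t)).le_opNNNorm (f t))

lemma add (hκ : IsDominatedKernel T ω κ) (hℓ : IsDominatedKernel T ω ℓ) :
    IsDominatedKernel T ω (κ + ℓ) := by
  obtain ⟨C, hC, hb⟩ := hκ.bound
  obtain ⟨D, hD, hb'⟩ := hℓ.bound
  refine ⟨hκ.stronglyMeasurable.add hℓ.stronglyMeasurable, fun p hp => ?_, C + D, by positivity,
    fun p => ?_⟩
  · rw [Pi.add_apply, hκ.eq_zero p hp, hℓ.eq_zero p hp, add_zero]
  · rw [add_mul]
    exact (norm_add_le _ _).trans (add_le_add (hb p) (hb' p))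

lemma op_add (hω : IsWeight T ω) (hκ : IsDominatedKernel T ω κ) (hℓ : IsDominatedKernel T ω ℓ) :
    (hκ.add hℓ).op hω = hκ.op hω + hℓ.op hω := by
  ext1 f
  ext1
  filter_upwards [(hκ.add hℓ).coeFn_op hω f, hκ.coeFn_op hω f, hℓ.coeFn_op hω f,
    Lp.coeFn_add (hκ.op hω f) (hℓ.op hω f)] with x h1 h2 h3 h4
  rw [h1, add_apply, h4, Pi.add_apply, h2, h3,
    ← integral_add (hκ.integrable_apply hω f x) (hℓ.integrable_apply hω f x)]
  rfl

lemma norm_comp_le (hκ : IsDominatedKernel T ω κ)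
    (hℓ : IsDominatedKernel T ω ℓ) :
    ∃ C, 0 ≤ C ∧ ∀ x s t, ‖κ (x, s) * ℓ (s, t)‖ ≤ C * ω x * ω s ^ 2 * ω t := by
  obtain ⟨C, hC, hb⟩ := hκ.bound
  obtain ⟨D, hD, hb'⟩ := hℓ.bound
  refine ⟨C * D, by positivity, fun x s t => (norm_mul_le _ _).trans ?_⟩
  refine (mul_le_mul (hb (x, s)) (hb' (s, t)) (norm_nonneg _)
    ((norm_nonneg _).trans (hb (x, s)))).trans_eq ?_
  ring

/-- The intermediate variable carries the integrable factor `ω(s)²`, so integrating it out leaves a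
multiple of `ω(x) ω(t)`. Triangularity survives because `t ≤ s ≤ x`. -/
lemma comp (hω : IsWeight T ω) (hκ : IsDominatedKernel T ω κ) (hℓ : IsDominatedKernel T ω ℓ) :
    IsDominatedKernel T ω (kernelComp κ ℓ) := by
  obtain ⟨C, hC, hb⟩ := hκ.norm_comp_le hℓ
  refine ⟨?_, fun p hp => ?_, C * ∫ s, ω s ^ 2, ?_, fun p => ?_⟩
  · refine StronglyMeasurable.integral_prod_right (f := fun (p : ℝ × ℝ) (s : ℝ) => κ (p.1, s) * ℓ (s, p.2)) ?_
    exact (hκ.stronglyMeasurable.comp_measurable (by fun_prop)).mul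
      (hℓ.stronglyMeasurable.comp_measurable (by fun_prop))
  · refine (integral_congr_ae (.of_forall fun s => ?_)).trans (integral_zero ℝ (Op r))
    by_cases h1 : (p.1, s) ∈ triangle T
    · by_cases h2 : (s, p.2) ∈ triangle T
      · exact absurd ⟨h2.1, h2.2.1.trans h1.2.1, h1.2.2⟩ hp
      · simp [hℓ.eq_zero _ h2]
    · simp [hκ.eq_zero _ h1]
  · exact mul_nonneg hC (integral_nonneg fun s => sq_nonneg _)
  · refine (norm_integral_le_of_norm_le
      ((hω.integrable_sq.const_mul (C * ω p.1)).mul_const (ω p.2))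
      (.of_forall fun s => hb p.1 s p.2)).trans_eq ?_
    rw [integral_mul_const, integral_const_mul]
    ring

lemma kernelComp_eq_integral_intervalMeasure (hκ : IsDominatedKernel T ω κ) (p : ℝ × ℝ) :
    kernelComp κ ℓ p = ∫ s, κ (p.1, s) * ℓ (s, p.2) ∂(intervalMeasure T) := by
  refine (setIntegral_eq_integral_of_forall_compl_eq_zero fun s hs => ?_).symm
  rw [hκ.eq_zero, zero_mul]
  exact fun h => hs ⟨h.1, h.2.1.trans h.2.2⟩

/-- Fubini for fixed `x`: the integrand is dominated by a constant times `ω(s)² · ω(t) ‖f(t)‖`, and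
`ω ‖f‖` is integrable as a product of two square-integrable functions. -/
lemma op_comp (hω : IsWeight T ω) (hκ : IsDominatedKernel T ω κ) (hℓ : IsDominatedKernel T ω ℓ) :
    (hκ.comp hω hℓ).op hω = hκ.op hω ∘L hℓ.op hω := by
  ext1 f
  ext1
  obtain ⟨C, hC, hb⟩ := hκ.norm_comp_le hℓ
  filter_upwards [(hκ.comp hω hℓ).coeFn_op hω f, hκ.coeFn_op hω (hℓ.op hω f)] with x h1 h2
  rw [h1, ContinuousLinearMap.comp_apply, h2]
  have hωf : Integrable (fun t => ω t * ‖f t‖) (intervalMeasure T) :=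
    (hω.memLp.restrict _).integrable_mul (Lp.memLp f).norm
  have hint : Integrable (Function.uncurry fun s t => (κ (x, s) * ℓ (s, t)) (f t))
      ((intervalMeasure T).prod (intervalMeasure T)) := by
    refine Integrable.mono' (((hω.integrable_sq.restrict (s := Ioc 0 T)).mul_prod hωf).const_mul
      (C * ω x)) ?_ (.of_forall fun p => ?_)
    · refine (ContinuousLinearMap.id ℂ (Op r)).aestronglyMeasurable_comp₂
        (StronglyMeasurable.aestronglyMeasurable ?_) (Lp.aestronglyMeasurable f).comp_snd
      exact (hκ.stronglyMeasurable.comp_measurable (by fun_prop)).mul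
        (hℓ.stronglyMeasurable.comp_measurable (by fun_prop))
    · refine (ContinuousLinearMap.le_opNorm _ _).trans
        ((mul_le_mul_of_nonneg_right (hb x p.1 p.2) (norm_nonneg _)).trans_eq ?_)
      ring
  have hint' (t : ℝ) : Integrable (fun s => κ (x, s) * ℓ (s, t)) (intervalMeasure T) := by
    refine Integrable.mono' (((hω.integrable_sq.restrict (s := Ioc 0 T)).const_mul
      (C * ω x)).mul_const (ω t)) (StronglyMeasurable.aestronglyMeasurable ?_)
      (.of_forall fun s => hb x s t)
    exact (hκ.stronglyMeasurable.comp_measurable (by fun_prop)).mul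
        (hℓ.stronglyMeasurable.comp_measurable (by fun_prop))
  calc ∫ t, kernelComp κ ℓ (x, t) (f t) ∂(intervalMeasure T)
      = ∫ t, ∫ s, (κ (x, s) * ℓ (s, t)) (f t) ∂(intervalMeasure T) ∂(intervalMeasure T) := by
        refine integral_congr_ae (.of_forall fun t => ?_)
        simp only [hκ.kernelComp_eq_integral_intervalMeasure]
        exact ContinuousLinearMap.integral_apply (hint' t) (f t)
    _ = ∫ s, ∫ t, (κ (x, s) * ℓ (s, t)) (f t) ∂(intervalMeasure T) ∂(intervalMeasure T) :=
        (integral_integral_swap hint).symm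
    _ = ∫ s, κ (x, s) (hℓ.op hω f s) ∂(intervalMeasure T) := by
        refine integral_congr_ae ?_
        filter_upwards [hℓ.coeFn_op hω f] with s hs
        rw [hs, ← ContinuousLinearMap.integral_comp_comm _ (hℓ.integrable_apply hω f s)]
        rfl

lemma op_congr (hω : IsWeight T ω) (hκ : IsDominatedKernel T ω κ) (hℓ : IsDominatedKernel T ω ℓ)
    (h : κ = ℓ) : hκ.op hω = hℓ.op hω := by
  subst h
  rfl

lemma op_const (hω : IsWeight T ω) (hκ : IsDominatedKernel T ω κ)
    (c : EuclideanSpace ℂ (Fin r)) :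
    hκ.op hω (Lp.const 2 (intervalMeasure T) c) =ᵐ[intervalMeasure T]
      fun x => (∫ t, κ (x, t)) c := by
  filter_upwards [hκ.coeFn_op hω (Lp.const 2 (intervalMeasure T) c)] with x hx
  obtain ⟨C, hC, hb⟩ := hκ.bound
  have hi : Integrable fun t => κ (x, t) := by
    refine Integrable.mono' (hω.integrable.const_mul (C * ω x))
      (hκ.stronglyMeasurable.comp_measurable measurable_prodMk_left).aestronglyMeasurable
      (.of_forall fun t => ?_)
    rw [mul_assoc]
    exact hb (x, t)
  have h0 : ∫ t in Ioc 0 T, κ (x, t) c = ∫ t, κ (x, t) c := by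
    refine setIntegral_eq_integral_of_forall_compl_eq_zero fun t ht => ?_
    rw [hκ.eq_zero, zero_apply]
    exact fun h => ht ⟨h.1, h.2.1.trans h.2.2⟩
  rw [hx, ContinuousLinearMap.integral_apply hi, ← h0]
  refine integral_congr_ae ?_
  filter_upwards [Lp.coeFn_const (μ := intervalMeasure T) (p := 2) c] with t ht
  rw [ht, Function.const_apply]

end IsDominatedKernel

/-! ### The kernel of the transformation operator -/

variable {r : ℕ} {T : ℝ} {ω : ℝ → ℝ} {κ ℓ q : ℝ × ℝ → Op r}

/-- The integral of the kernel `κ` over the part below height `t` of the line through `(x, t)`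
parallel to the diagonal. -/
def diagonalIntegral (κ : ℝ × ℝ → Op r) (p : ℝ × ℝ) : Op r :=
  ∫ s in Iic p.2, κ (p.1 - p.2 + s, s)

/-! ### Weight estimates along diagonals -/

namespace IsWeight

lemma integrable_sq_shift (hω : IsWeight T ω) (y : ℝ) : Integrable fun s => ω (y + s) ^ 2 :=
  hω.integrable_sq.comp_add_left y

lemma integrable_shift_mul (hω : IsWeight T ω) (y : ℝ) : Integrable fun s => ω (y + s) * ω s := by
  have h : MemLp (fun s => ω (y + s)) 2 volume :=
    hω.memLp.comp_measurePreserving (measurePreserving_add_left volume y)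
  exact h.integrable_mul hω.memLp

/-- `2ab ≤ a² + b²` and translation invariance. Uniformity in `y` is what bounds integrals along all
diagonals at once. -/
lemma integral_shift_mul_le (hω : IsWeight T ω) (y : ℝ) :
    ∫ s, ω (y + s) * ω s ≤ ∫ s, ω s ^ 2 := by
  have h1 : ∫ s, ω (y + s) ^ 2 = ∫ s, ω s ^ 2 :=
    integral_add_left_eq_self (fun s => ω s ^ 2) y
  calc ∫ s, ω (y + s) * ω s
      ≤ ∫ s, (1 / 2 * ω (y + s) ^ 2 + 1 / 2 * ω s ^ 2) :=
        integral_mono (hω.integrable_shift_mul y)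
          (((hω.integrable_sq_shift y).const_mul _).add (hω.integrable_sq.const_mul _))
          fun s => by nlinarith [sq_nonneg (ω (y + s) - ω s)]
    _ = ∫ s, ω s ^ 2 := by
        rw [integral_add ((hω.integrable_sq_shift y).const_mul _) (hω.integrable_sq.const_mul _),
          integral_const_mul, integral_const_mul, h1]
        ring

/-- Source of the contraction: a large exponential rate `c` makes the factor `δ` arbitrarily small,
uniformly in the shift `y`. As `ω` is only square-integrable, it is separated from the exponential
by Young's inequality with parameter `ε`. -/
lemma exists_integral_mul_exp_le (hω : IsWeight T ω) {δ : ℝ} (hδ : 0 < δ) :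
    ∃ c, 0 < c ∧ ∀ y t, IntegrableOn (fun s => ω (y + s) * Real.exp (c * s)) (Iic t) ∧
      ∫ s in Iic t, ω (y + s) * Real.exp (c * s) ≤ δ * Real.exp (c * t) := by
  set W := ∫ s, ω s ^ 2
  have hW : 0 ≤ W := integral_nonneg fun s => sq_nonneg _
  -- After integration the two Young terms contribute `ε W / 2` and `1 / (4 ε c)` times `exp (c t)`.
  -- This `ε` makes the first at most `δ / 2`, and `c = 1 / (2 ε δ)` makes the second equal to `δ /
  -- 2`.
  set ε := δ / (W + 1)
  have hε : 0 < ε := by positivity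
  have hεW : ε * W ≤ δ := by
    rw [div_mul_eq_mul_div, div_le_iff₀ (by positivity)]
    nlinarith
  set c := 1 / (2 * ε * δ)
  have hc : 0 < c := by positivity
  refine ⟨c, hc, fun y t => ?_⟩
  have he : Real.exp (c * t) * Real.exp (-(c * t)) = 1 := by
    rw [← Real.exp_add, add_neg_cancel, Real.exp_zero]
  have hdom (s : ℝ) : ω (y + s) * Real.exp (c * s) ≤ ε / 2 * Real.exp (c * t) * ω (y + s) ^ 2 +
      1 / (2 * ε) * Real.exp (-(c * t)) * Real.exp (2 * c * s) := by
    have h1 : Real.exp (2 * c * s) = Real.exp (c * s) ^ 2 := by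
      rw [← Real.exp_nat_mul]
      push_cast
      ring_nf
    have h2 : 1 / (2 * ε) * (2 * ε) = 1 := by field_simp
    set a := ω (y + s)
    set b := Real.exp (c * s)
    set P := Real.exp (c * t)
    set R := Real.exp (-(c * t))
    have hR : 0 < R := Real.exp_pos _
    -- Completing the square, with `P R = 1`.
    have key : ε / 2 * P * a ^ 2 + 1 / (2 * ε) * R * b ^ 2 - a * b =
        R / (2 * ε) * (ε * P * a - b) ^ 2 := by
      have hP : P = 1 / R := by rw [eq_div_iff hR.ne']; exact he
      rw [hP]
      field_simp
      ring
    have : 0 ≤ R / (2 * ε) * (ε * P * a - b) ^ 2 := by positivity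
    rw [h1]
    linarith
  have hi : IntegrableOn (fun s => ε / 2 * Real.exp (c * t) * ω (y + s) ^ 2 +
      1 / (2 * ε) * Real.exp (-(c * t)) * Real.exp (2 * c * s)) (Iic t) :=
    ((hω.integrable_sq_shift y).const_mul _).integrableOn.add
      ((integrableOn_exp_mul_Iic (by positivity) t).const_mul _)
  have hi' : IntegrableOn (fun s => ω (y + s) * Real.exp (c * s)) (Iic t) := by
    refine hi.mono' ?_ (.of_forall fun s => ?_)
    · exact ((hω.measurable.comp (measurable_const_add y)).mul
        (by fun_prop : Measurable fun s => Real.exp (c * s))).aestronglyMeasurable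
    · rw [Real.norm_of_nonneg (mul_nonneg (hω.nonneg _) (Real.exp_pos _).le)]
      exact hdom s
  refine ⟨hi', (integral_mono hi' hi hdom).trans ?_⟩
  rw [integral_add ((hω.integrable_sq_shift y).const_mul _).integrableOn
    ((integrableOn_exp_mul_Iic (by positivity) t).const_mul _), integral_const_mul,
    integral_const_mul, integral_exp_mul_Iic (by positivity)]
  have h3 : ∫ s in Iic t, ω (y + s) ^ 2 ≤ W := by
    refine (setIntegral_le_integral (hω.integrable_sq_shift y)
      (.of_forall fun s => sq_nonneg _)).trans_eq ?_
    exact integral_add_left_eq_self (fun s => ω s ^ 2) y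
  have h4 : 1 / (2 * ε) * Real.exp (-(c * t)) * (Real.exp (2 * c * t) / (2 * c)) =
      δ / 2 * Real.exp (c * t) := by
    have : Real.exp (2 * c * t) = Real.exp (c * t) * Real.exp (c * t) := by
      rw [← Real.exp_add]; ring_nf
    rw [this]
    have hc' : 1 / (2 * ε) * (1 / (2 * c)) = δ / 2 := by
      simp only [c]; field_simp
    linear_combination (Real.exp (-(c * t)) * Real.exp (c * t) * Real.exp (c * t)) * hc' +
      δ / 2 * Real.exp (c * t) * he
  rw [h4]
  have h5 : ε / 2 * Real.exp (c * t) * (∫ s in Iic t, ω (y + s) ^ 2) ≤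
      ε / 2 * Real.exp (c * t) * W := mul_le_mul_of_nonneg_left h3 (by positivity)
  nlinarith [mul_le_mul_of_nonneg_right hεW (Real.exp_pos (c * t)).le]

end IsWeight

/-- The right-hand side of the integral equation for the kernel of the transformation operator. -/
def transformStep (T : ℝ) (q κ : ℝ × ℝ → Op r) : ℝ × ℝ → Op r :=
  (triangle T).indicator (diagonalIntegral (q + kernelComp q κ))

/-- On the triangle both variables lie in `(0, T]`, where the weight is at least one. One class
therefore contains both the bounded kernels and the unbounded kernel built from `v`. -/
lemma IsDominatedKernel.of_bounded (hω : IsWeight T ω) (hm : StronglyMeasurable κ)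
    (h0 : ∀ p ∉ triangle T, κ p = 0) {C : ℝ} (hC : ∀ p, ‖κ p‖ ≤ C) :
    IsDominatedKernel T ω κ := by
  have hC0 : 0 ≤ C := (norm_nonneg _).trans (hC 0)
  refine ⟨hm, h0, C, hC0, fun p => ?_⟩
  by_cases hp : p ∈ triangle T
  · have h1 : 1 ≤ ω p.1 := hω.one_le _ ⟨hp.1.trans_le hp.2.1, hp.2.2⟩
    have h2 : 1 ≤ ω p.2 := hω.one_le _ ⟨hp.1, hp.2.1.trans hp.2.2⟩
    exact (hC p).trans (le_mul_of_one_le_right hC0 (one_le_mul_of_one_le_of_one_le h1 h2))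
  · rw [h0 p hp, norm_zero]
    exact mul_nonneg hC0 (mul_nonneg (hω.nonneg _) (hω.nonneg _))

namespace IsDominatedKernel

lemma integrable_diagonal (hω : IsWeight T ω) (hκ : IsDominatedKernel T ω κ) (y : ℝ) :
    Integrable fun s => κ (y + s, s) := by
  obtain ⟨C, hC, hb⟩ := hκ.bound
  exact ((hω.integrable_shift_mul y).const_mul C).mono'
    (hκ.stronglyMeasurable.comp_measurable (by fun_prop)).aestronglyMeasurable
    (.of_forall fun s => hb _)

/-- Integration along diagonals turns domination by `ω(x) ω(t)` into a uniform bound; this is why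
the transformation kernel is bounded although `v` need not be. -/
lemma exists_norm_diagonalIntegral_le (hω : IsWeight T ω) (hκ : IsDominatedKernel T ω κ) :
    ∃ D, 0 ≤ D ∧ ∀ p, ‖diagonalIntegral κ p‖ ≤ D := by
  obtain ⟨C, hC, hb⟩ := hκ.bound
  refine ⟨C * ∫ s, ω s ^ 2, mul_nonneg hC (integral_nonneg fun s => sq_nonneg _), fun p => ?_⟩
  refine (norm_integral_le_of_norm_le ((hω.integrable_shift_mul _).const_mul C).integrableOn
    (.of_forall fun s => hb _)).trans ?_
  refine (setIntegral_le_integral ((hω.integrable_shift_mul _).const_mul C)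
    (.of_forall fun s => mul_nonneg hC (mul_nonneg (hω.nonneg _) (hω.nonneg _)))).trans ?_
  rw [integral_const_mul]
  exact mul_le_mul_of_nonneg_left (hω.integral_shift_mul_le _) hC

lemma stronglyMeasurable_diagonalIntegral (hκ : IsDominatedKernel T ω κ) :
    StronglyMeasurable (diagonalIntegral κ) := by
  have h : diagonalIntegral κ = fun p : ℝ × ℝ =>
      ∫ s, {z : (ℝ × ℝ) × ℝ | z.2 ≤ z.1.2}.indicator
        (fun z => κ (z.1.1 - z.1.2 + z.2, z.2)) (p, s) := by
    funext p
    rw [diagonalIntegral, ← integral_indicator measurableSet_Iic]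
    rfl
  rw [h]
  refine StronglyMeasurable.integral_prod_right (f := fun (p : ℝ × ℝ) (s : ℝ) =>
    {z : (ℝ × ℝ) × ℝ | z.2 ≤ z.1.2}.indicator (fun z => κ (z.1.1 - z.1.2 + z.2, z.2)) (p, s)) ?_
  exact (hκ.stronglyMeasurable.comp_measurable (by fun_prop)).indicator
    (measurableSet_le (by fun_prop) (by fun_prop))

lemma indicator_diagonalIntegral (hω : IsWeight T ω) (hκ : IsDominatedKernel T ω κ) :
    IsDominatedKernel T ω ((triangle T).indicator (diagonalIntegral κ)) := by
  obtain ⟨D, hD, hb⟩ := hκ.exists_norm_diagonalIntegral_le hω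
  exact .of_bounded hω
    (hκ.stronglyMeasurable_diagonalIntegral.indicator (measurableSet_triangle T))
    (fun p hp => indicator_of_notMem hp _)
    fun p => (norm_indicator_le_norm_self _ _).trans (hb p)

lemma transformStep (hω : IsWeight T ω) (hq : IsDominatedKernel T ω q)
    (hκ : IsDominatedKernel T ω κ) : IsDominatedKernel T ω (transformStep T q κ) :=
  (hq.add (hq.comp hω hκ)).indicator_diagonalIntegral hω

/-- Contraction with factor `1/2` in the norm weighted by `exp (c t)`. Composing with `q` on the
left leaves `t` fixed, so it preserves the weight and costs `C W ω(x)`; the diagonal integral of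
`ω(x) exp (c t)` then supplies the small factor. -/
lemma exists_norm_transformStep_sub_le (hω : IsWeight T ω) (hq : IsDominatedKernel T ω q) :
    ∃ c, 0 < c ∧ ∀ κ ℓ D, IsDominatedKernel T ω κ → IsDominatedKernel T ω ℓ →
      (∀ p, ‖κ p - ℓ p‖ ≤ D * Real.exp (c * p.2)) →
      ∀ p, ‖DiracSim.transformStep T q κ p - DiracSim.transformStep T q ℓ p‖ ≤
        1 / 2 * D * Real.exp (c * p.2) := by
  obtain ⟨C, hC, hb⟩ := hq.bound
  set W := ∫ s, ω s
  have hW : 0 ≤ W := integral_nonneg hω.nonneg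
  -- Chosen so that `C W δ ≤ 1/2`; the summand `1` covers the case `C W = 0`.
  obtain ⟨c, hc, H⟩ := hω.exists_integral_mul_exp_le (δ := 1 / (2 * (C * W + 1))) (by positivity)
  refine ⟨c, hc, fun κ ℓ D hκ hℓ hD p => ?_⟩
  have hD0 : 0 ≤ D := by
    have := (norm_nonneg _).trans (hD p)
    exact nonneg_of_mul_nonneg_left this (Real.exp_pos _)
  have hcomp (a b : ℝ) : ‖kernelComp q κ (a, b) - kernelComp q ℓ (a, b)‖ ≤
      C * W * D * (ω a * Real.exp (c * b)) := by
    have hi : ∀ {m : ℝ × ℝ → Op r}, IsDominatedKernel T ω m →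
        Integrable fun s => q (a, s) * m (s, b) := by
      intro m hm
      obtain ⟨K, hK, hKb⟩ := hq.norm_comp_le hm
      refine ((hω.integrable_sq.const_mul (K * ω a)).mul_const (ω b)).mono'
        (StronglyMeasurable.aestronglyMeasurable ?_) (.of_forall fun s => hKb a s b)
      exact (hq.stronglyMeasurable.comp_measurable (by fun_prop)).mul
        (hm.stronglyMeasurable.comp_measurable (by fun_prop))
    rw [kernelComp, kernelComp, ← integral_sub (hi hκ) (hi hℓ)]
    refine (norm_integral_le_of_norm_le (hω.integrable.const_mul
      (C * ω a * (D * Real.exp (c * b)))) (.of_forall fun s => ?_)).trans_eq ?_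
    · rw [← mul_sub]
      refine (norm_mul_le _ _).trans ((mul_le_mul (hb (a, s)) (hD (s, b)) (norm_nonneg _)
        ((norm_nonneg _).trans (hb (a, s)))).trans_eq ?_)
      ring
    · rw [integral_const_mul]
      ring
  by_cases hp : p ∈ triangle T
  · rw [DiracSim.transformStep, DiracSim.transformStep, indicator_of_mem hp, indicator_of_mem hp,
      diagonalIntegral, diagonalIntegral,
      ← integral_sub ((hq.add (hq.comp hω hκ)).integrable_diagonal hω _).integrableOn
        ((hq.add (hq.comp hω hℓ)).integrable_diagonal hω _).integrableOn]
    obtain ⟨h1, h2⟩ := H (p.1 - p.2) p.2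
    refine (norm_integral_le_of_norm_le (h1.const_mul (C * W * D))
      (.of_forall fun s => ?_)).trans ?_
    · simp only [Pi.add_apply, add_sub_add_left_eq_sub]
      exact hcomp _ _
    · rw [integral_const_mul]
      refine (mul_le_mul_of_nonneg_left h2 (by positivity)).trans ?_
      have h3 : C * W * (1 / (2 * (C * W + 1))) ≤ 1 / 2 := by
        rw [mul_one_div, div_le_div_iff₀ (by positivity) (by positivity)]
        nlinarith [mul_nonneg hC hW]
      calc C * W * D * (1 / (2 * (C * W + 1)) * Real.exp (c * p.2))
          = C * W * (1 / (2 * (C * W + 1))) * (D * Real.exp (c * p.2)) := by ring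
        _ ≤ 1 / 2 * (D * Real.exp (c * p.2)) :=
          mul_le_mul_of_nonneg_right h3 (by positivity)
        _ = _ := by ring
  · rw [DiracSim.transformStep, DiracSim.transformStep, indicator_of_notMem hp,
      indicator_of_notMem hp, sub_zero, norm_zero]
    positivity

/-- The integral equation for the kernel of the transformation operator has a bounded solution. -/
lemma exists_eq_transformStep (hω : IsWeight T ω) (hq : IsDominatedKernel T ω q) :
    ∃ κ, IsDominatedKernel T ω κ ∧ (∃ C, ∀ p, ‖κ p‖ ≤ C) ∧ κ = DiracSim.transformStep T q κ := by
  obtain ⟨c, hc, H⟩ := hq.exists_norm_transformStep_sub_le hω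
  -- Picard iteration from zero. Successive differences shrink geometrically in the weighted norm,
  -- so the iterates converge at every point, with explicit rate.
  set S : ℕ → ℝ × ℝ → Op r := fun n => (DiracSim.transformStep T q)^[n] 0
  have hS0 : S 0 = 0 := rfl
  have hSs (n : ℕ) : S (n + 1) = DiracSim.transformStep T q (S n) :=
    Function.iterate_succ_apply' _ _ _
  have hdom (n : ℕ) : IsDominatedKernel T ω (S n) := by
    induction n with
    | zero =>
      exact ⟨stronglyMeasurable_const, fun _ _ => rfl, 0, le_rfl, fun p => by simp [hS0]⟩
    | succ n ih => rw [hSs]; exact hq.transformStep hω ih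
  obtain ⟨D, hD, hDb⟩ := (hq.add (hq.comp hω (hdom 0))).exists_norm_diagonalIntegral_le hω
  have hstep (n : ℕ) (p : ℝ × ℝ) :
      ‖S (n + 1) p - S n p‖ ≤ D * (1 / 2) ^ n * Real.exp (c * p.2) := by
    induction n generalizing p with
    | zero =>
      rw [hSs, hS0, Pi.zero_apply, sub_zero, pow_zero, mul_one]
      by_cases hp : p ∈ triangle T
      · rw [DiracSim.transformStep, indicator_of_mem hp]
        exact (hDb p).trans (le_mul_of_one_le_right hD
          (Real.one_le_exp (mul_nonneg hc.le hp.1.le)))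
      · rw [DiracSim.transformStep, indicator_of_notMem hp, norm_zero]
        positivity
    | succ n ih =>
      rw [hSs (n + 1), hSs n]
      refine (H _ _ _ (hSs n ▸ hdom (n + 1)) (hdom n) (hSs n ▸ ih) p).trans_eq ?_
      ring
  have hdist (p : ℝ × ℝ) (n : ℕ) :
      dist (S n p) (S (n + 1) p) ≤ D * Real.exp (c * p.2) * (1 / 2) ^ n := by
    rw [dist_comm, dist_eq_norm]
    exact (hstep n p).trans_eq (by ring)
  choose κ hκ using fun p =>
    cauchySeq_tendsto_of_complete (cauchySeq_of_le_geometric _ _ (by norm_num) (hdist p))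
  have hlim (p : ℝ × ℝ) (n : ℕ) : ‖κ p - S n p‖ ≤ 2 * D * (1 / 2) ^ n * Real.exp (c * p.2) := by
    have := dist_le_of_le_geometric_of_tendsto _ _ (by norm_num) (hdist p) (hκ p) n
    rw [dist_comm, dist_eq_norm] at this
    exact this.trans_eq (by ring)
  have hm : StronglyMeasurable κ :=
    stronglyMeasurable_of_tendsto Filter.atTop (fun n => (hdom n).stronglyMeasurable)
      (tendsto_pi_nhds.2 hκ)
  have h0 (p : ℝ × ℝ) (hp : p ∉ triangle T) : κ p = 0 := by
    refine tendsto_nhds_unique (hκ p) ?_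
    simp only [(hdom _).eq_zero p hp]
    exact tendsto_const_nhds
  have hbd (p : ℝ × ℝ) : ‖κ p‖ ≤ 2 * D * Real.exp (c * T) := by
    by_cases hp : p ∈ triangle T
    · have := hlim p 0
      rw [hS0, Pi.zero_apply, sub_zero, pow_zero, mul_one] at this
      refine this.trans (mul_le_mul_of_nonneg_left (Real.exp_le_exp.2 ?_) (by positivity))
      exact mul_le_mul_of_nonneg_left (hp.2.1.trans hp.2.2) hc.le
    · rw [h0 p hp, norm_zero]
      positivity
  have hκd : IsDominatedKernel T ω κ := .of_bounded hω hm h0 hbd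
  refine ⟨κ, hκd, ⟨_, hbd⟩, ?_⟩
  funext p
  -- `S (n + 1) p` tends to `κ p`, and by the contraction estimate also to the step applied to `κ`.
  refine tendsto_nhds_unique ((Filter.tendsto_add_atTop_iff_nat 1).2 (hκ p)) ?_
  rw [tendsto_iff_norm_sub_tendsto_zero]
  have hz : Filter.Tendsto (fun n : ℕ => 1 / 2 * (2 * D * (1 / 2) ^ n) * Real.exp (c * p.2))
      Filter.atTop (nhds 0) := by
    have := (tendsto_pow_atTop_nhds_zero_of_lt_one (r := (1 / 2 : ℝ)) (by norm_num)
      (by norm_num)).const_mul (D * Real.exp (c * p.2))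
    rw [mul_zero] at this
    exact this.congr fun n => by ring
  refine squeeze_zero (fun n => norm_nonneg _) (fun n => ?_) hz
  rw [hSs, norm_sub_rev]
  exact H _ _ _ hκd (hdom n) (fun p => hlim p n) p

end IsDominatedKernel

/-! ### The commutation identity for integrals along diagonals -/

variable {r : ℕ} {T : ℝ} {ω : ℝ → ℝ} {κ ℓ q M : ℝ × ℝ → Op r}

section Shear

variable {F : Type*} [NormedAddCommGroup F] [NormedSpace ℝ F]

/-- For fixed `t` the substitution is a reflection followed by a translation in `s`, so the plane
map preserves area. It parametrizes points by the height `s` at which their diagonal meets the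
vertical line at `y`. -/
lemma integral_integral_sub_shear {g : ℝ × ℝ → F} (hg : Integrable g) (y : ℝ) :
    ∫ s, ∫ t, g (t, y + t - s) = ∫ z, g z := by
  have hmp : MeasurePreserving (fun p : ℝ × ℝ => (p.1, y + p.1 - p.2))
      (volume.prod volume) (volume.prod volume) :=
    (MeasurePreserving.id volume).skew_product (g := fun t s : ℝ => y + t - s) (by fun_prop)
      (.of_forall fun t => (volume.measurePreserving_sub_left (y + t)).map_eq)
  have hi : Integrable (Function.uncurry fun t s : ℝ => g (t, y + t - s))
      (volume.prod volume) := hmp.integrable_comp_of_integrable hg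
  rw [← integral_integral_swap hi]
  refine (integral_congr_ae (.of_forall fun t => ?_)).trans (integral_prod g hg).symm
  exact integral_sub_left_eq_self (fun a => g (t, a)) volume (y + t)

/-- Companion of the previous shear: here `s` is the abscissa at which the diagonal meets the
horizontal line at height `y`. -/
lemma integral_integral_add_shear {g : ℝ × ℝ → F} (hg : Integrable g) (y : ℝ) :
    ∫ s, ∫ t, g (t, s + (t - y)) = ∫ z, g z := by
  have hmp : MeasurePreserving (fun p : ℝ × ℝ => (p.1, p.2 + (p.1 - y)))
      (volume.prod volume) (volume.prod volume) :=
    (MeasurePreserving.id volume).skew_product (g := fun t s : ℝ => s + (t - y)) (by fun_prop)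
      (.of_forall fun t => (measurePreserving_add_right volume (t - y)).map_eq)
  have hi : Integrable (Function.uncurry fun t s : ℝ => g (t, s + (t - y)))
      (volume.prod volume) := hmp.integrable_comp_of_integrable hg
  rw [← integral_integral_swap hi]
  refine (integral_congr_ae (.of_forall fun t => ?_)).trans (integral_prod g hg).symm
  exact integral_add_right_eq_self (fun a => g (t, a)) (t - y)

end Shear

namespace IsDominatedKernel

/-- Integrated form of `(∂ₓ + ∂ₜ) κ = M` over the triangle with corners `(t, t)`, `(x, t)`, `(x,
x)`. Each integral of `κ` over a side is an area integral of `M` over the diagonals ending on that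
side, and the two regions differ exactly by the triangle. -/
lemma integral_diagonalIntegral_sub (hω : IsWeight T ω) (hM : IsDominatedKernel T ω M)
    (hκ : κ = (triangle T).indicator (diagonalIntegral M)) {x t : ℝ} (ht : 0 ≤ t)
    (hx : x ≤ T) :
    (∫ s in Ioc t x, κ (x, s)) - ∫ s in Ioc t x, κ (s, t) =
      ∫ s in Ioc t x, ∫ a in Ioc t s, M (s, a) := by
  have hMs : Integrable fun z : ℝ × ℝ => M (z.2, z.1) := (hM.integrable hω).swap
  -- Coordinates are swapped: `z = (a, b)` stands for the argument `(b, a)` of `M`. `S₁` and `S₂`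
  -- consist of points whose diagonal runs up to the vertical side and to the horizontal side
  -- respectively; `S₃` is the triangle between the sides.
  set S₁ : Set (ℝ × ℝ) := {z | (t < x + z.1 - z.2 ∧ x + z.1 - z.2 ≤ x) ∧ z.1 ≤ x + z.1 - z.2}
  set S₂ : Set (ℝ × ℝ) := {z | (t ≤ z.2 - (z.1 - t) ∧ z.2 - (z.1 - t) < x) ∧ z.1 ≤ t}
  set S₃ : Set (ℝ × ℝ) := {z | (t < z.2 ∧ z.2 ≤ x) ∧ t < z.1 ∧ z.1 ≤ z.2}
  have hS₁ : MeasurableSet S₁ :=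
    ((measurableSet_lt (f := fun z : ℝ × ℝ => t) (g := fun z => x + z.1 - z.2) (by fun_prop) (by fun_prop)).inter
      (measurableSet_le (f := fun z : ℝ × ℝ => x + z.1 - z.2) (g := fun z => x) (by fun_prop) (by fun_prop))).inter
      (measurableSet_le (f := fun z : ℝ × ℝ => z.1) (g := fun z => x + z.1 - z.2) (by fun_prop) (by fun_prop))
  have hS₂ : MeasurableSet S₂ :=
    ((measurableSet_le (f := fun z : ℝ × ℝ => t) (g := fun z => z.2 - (z.1 - t)) (by fun_prop) (by fun_prop)).inter
      (measurableSet_lt (f := fun z : ℝ × ℝ => z.2 - (z.1 - t)) (g := fun z => x) (by fun_prop) (by fun_prop))).inter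
      (measurableSet_le (f := fun z : ℝ × ℝ => z.1) (g := fun z => t) (by fun_prop) (by fun_prop))
  have hS₃ : MeasurableSet S₃ :=
    ((measurableSet_lt (f := fun z : ℝ × ℝ => t) (g := fun z => z.2) (by fun_prop) (by fun_prop)).inter
      (measurableSet_le (f := fun z : ℝ × ℝ => z.2) (g := fun z => x) (by fun_prop) (by fun_prop))).inter
      ((measurableSet_lt (f := fun z : ℝ × ℝ => t) (g := fun z => z.1) (by fun_prop) (by fun_prop)).inter
        (measurableSet_le (f := fun z : ℝ × ℝ => z.1) (g := fun z => z.2) (by fun_prop) (by fun_prop)))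
  have h₁ : ∫ s in Ioc t x, κ (x, s) = ∫ z in S₁, M (z.2, z.1) := by
    rw [← integral_indicator hS₁, ← integral_integral_sub_shear (hMs.indicator hS₁) x,
      ← integral_indicator measurableSet_Ioc]
    refine integral_congr_ae (.of_forall fun s => ?_)
    by_cases hs : s ∈ Ioc t x
    · have hsT : (x, s) ∈ triangle T := ⟨ht.trans_lt hs.1, hs.2, hx⟩
      simp only [indicator_of_mem hs, hκ, indicator_of_mem hsT, diagonalIntegral]
      rw [← integral_indicator measurableSet_Iic]
      refine integral_congr_ae (.of_forall fun a => ?_)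
      by_cases ha : a ≤ s
      · have : (a, x + a - s) ∈ S₁ := by
          simp only [S₁, mem_ofPred_eq]
          refine ⟨⟨?_, ?_⟩, ?_⟩ <;> linarith [hs.1, hs.2]
        simp only [indicator_of_mem (show a ∈ Iic s from ha), indicator_of_mem this]
        congr 2
        ring
      · have : (a, x + a - s) ∉ S₁ := fun h => ha (by
          have := h.2
          simp only at this
          linarith)
        simp only [indicator_of_notMem (show a ∉ Iic s from ha), indicator_of_notMem this]
    · simp only [indicator_of_notMem hs]
      refine ((integral_congr_ae (.of_forall fun a => ?_)).trans (integral_zero ℝ (Op r))).symm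
      refine indicator_of_notMem (fun h => hs ?_) _
      have := h.1
      simp only at this
      constructor <;> linarith [this.1, this.2]
  have h₂ : ∫ s in Ioc t x, κ (s, t) = ∫ z in S₂, M (z.2, z.1) := by
    -- The half-open end is switched, at the cost of a null set, so that `S₁` is exactly the
    -- disjoint union of `S₂` and `S₃`.
    rw [← integral_Ico_eq_integral_Ioc, ← integral_indicator hS₂,
      ← integral_integral_add_shear (hMs.indicator hS₂) t, ← integral_indicator measurableSet_Ico]
    refine integral_congr_ae (.of_forall fun s => ?_)
    by_cases hs : s ∈ Ico t x
    · have hκs : κ (s, t) = ∫ a in Iic t, M (s - t + a, a) := by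
        rw [hκ]
        -- At `t = 0` the point `(s, t)` is outside the triangle, so `κ` vanishes there; the
        -- diagonal integral agrees because `M` vanishes for second argument at most zero.
        by_cases ht0 : 0 < t
        · have hsT : (s, t) ∈ triangle T := ⟨ht0, hs.1, hs.2.le.trans hx⟩
          rw [indicator_of_mem hsT, diagonalIntegral]
        · rw [indicator_of_notMem fun h => ht0 h.1]
          refine (setIntegral_eq_zero_of_forall_eq_zero fun a ha => hM.eq_zero _ fun h => ht0 ?_).symm
          exact h.1.trans_le ha
      simp only [indicator_of_mem hs, hκs]
      rw [← integral_indicator measurableSet_Iic]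
      refine integral_congr_ae (.of_forall fun a => ?_)
      by_cases ha : a ≤ t
      · have : (a, s + (a - t)) ∈ S₂ := by
          simp only [S₂, mem_ofPred_eq]
          refine ⟨⟨?_, ?_⟩, ?_⟩ <;> linarith [hs.1, hs.2]
        simp only [indicator_of_mem (show a ∈ Iic t from ha), indicator_of_mem this]
        congr 2
        ring
      · have : (a, s + (a - t)) ∉ S₂ := fun h => ha h.2
        simp only [indicator_of_notMem (show a ∉ Iic t from ha), indicator_of_notMem this]
    · simp only [indicator_of_notMem hs]
      refine ((integral_congr_ae (.of_forall fun a => ?_)).trans (integral_zero ℝ (Op r))).symm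
      refine indicator_of_notMem (fun h => hs ?_) _
      have := h.1
      simp only at this
      constructor <;> linarith [this.1, this.2]
  have h₃ : ∫ s in Ioc t x, ∫ a in Ioc t s, M (s, a) = ∫ z in S₃, M (z.2, z.1) := by
    rw [← integral_indicator hS₃, Measure.volume_eq_prod,
      integral_prod_symm _ (hMs.indicator hS₃), ← integral_indicator measurableSet_Ioc]
    refine integral_congr_ae (.of_forall fun s => ?_)
    by_cases hs : s ∈ Ioc t x
    · simp only [indicator_of_mem hs]
      rw [← integral_indicator measurableSet_Ioc]
      refine integral_congr_ae (.of_forall fun a => ?_)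
      by_cases ha : a ∈ Ioc t s
      · have : (a, s) ∈ S₃ := ⟨hs, ha⟩
        simp only [indicator_of_mem ha, indicator_of_mem this]
      · have : (a, s) ∉ S₃ := fun h => ha h.2
        simp only [indicator_of_notMem ha, indicator_of_notMem this]
    · simp only [indicator_of_notMem hs]
      refine ((integral_congr_ae (.of_forall fun a => ?_)).trans (integral_zero ℝ (Op r))).symm
      exact indicator_of_notMem (fun h => hs h.1) _
  -- In terms of `b - a`, `S₁` is `0 ≤ b - a < x - t`, `b ≤ x`; it splits according to `a ≤ t` or `a
  -- > t`.
  have hunion : S₁ = S₂ ∪ S₃ := by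
    ext ⟨a, b⟩
    simp only [S₁, S₂, S₃, mem_ofPred_eq, mem_union]
    constructor
    · rintro ⟨⟨h1, h2⟩, h3⟩
      by_cases ha : a ≤ t
      · exact Or.inl ⟨⟨by linarith, by linarith⟩, ha⟩
      · exact Or.inr ⟨⟨by linarith, by linarith⟩, by linarith, by linarith⟩
    · rintro (⟨⟨h1, h2⟩, h3⟩ | ⟨⟨h1, h2⟩, h3, h4⟩)
      · exact ⟨⟨by linarith, by linarith⟩, by linarith⟩
      · exact ⟨⟨by linarith, by linarith⟩, by linarith⟩
  have hdisj : Disjoint S₂ S₃ := by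
    rw [Set.disjoint_left]
    exact fun z h h' => absurd h.2 (not_le.2 h'.2.1)
  rw [h₁, h₂, h₃, hunion, setIntegral_union hdisj hS₃ hMs.integrableOn hMs.integrableOn]
  abel

end IsDominatedKernel

/-- The kernel of the operator of integration `∫₀ˣ · dt`. -/
def integrationKernel (r : ℕ) (T : ℝ) : ℝ × ℝ → Op r := (triangle T).indicator 1

lemma isDominatedKernel_integrationKernel (hω : IsWeight T ω) :
    IsDominatedKernel T ω (integrationKernel r T) :=
  .of_bounded hω (stronglyMeasurable_one.indicator (measurableSet_triangle T))
    (fun _ hp => indicator_of_notMem hp _) (C := ‖(1 : Op r)‖)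
    fun _ => norm_indicator_le_norm_self _ _

/-! ### The commutation relation for operators -/

namespace IsDominatedKernel

lemma kernelComp_integrationKernel (hκ : IsDominatedKernel T ω κ) {p : ℝ × ℝ}
    (hp : p ∈ triangle T) :
    kernelComp κ (integrationKernel r T) p = ∫ s in Ioc p.2 p.1, κ (p.1, s) := by
  rw [← integral_Icc_eq_integral_Ioc, ← integral_indicator measurableSet_Icc, kernelComp]
  refine integral_congr_ae (.of_forall fun s => ?_)
  by_cases hs : s ∈ Icc p.2 p.1
  · have : (s, p.2) ∈ triangle T := ⟨hp.1, hs.1, hs.2.trans hp.2.2⟩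
    simp [indicator_of_mem hs, integrationKernel, indicator_of_mem this]
  · rw [indicator_of_notMem hs]
    by_cases h : s ≤ p.1
    · have : (s, p.2) ∉ triangle T := fun h' => hs ⟨h'.2.1, h⟩
      simp [integrationKernel, indicator_of_notMem this]
    · simp [hκ.eq_zero (p.1, s) fun h' => h h'.2.1]

lemma kernelComp_integrationKernel_left (hκ : IsDominatedKernel T ω κ) {p : ℝ × ℝ}
    (hp : p ∈ triangle T) :
    kernelComp (integrationKernel r T) κ p = ∫ s in Ioc p.2 p.1, κ (s, p.2) := by
  rw [← integral_Icc_eq_integral_Ioc, ← integral_indicator measurableSet_Icc, kernelComp]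
  refine integral_congr_ae (.of_forall fun s => ?_)
  by_cases hs : s ∈ Icc p.2 p.1
  · have : (p.1, s) ∈ triangle T := ⟨hp.1.trans_le hs.1, hs.2, hp.2.2⟩
    simp [indicator_of_mem hs, integrationKernel, indicator_of_mem this]
  · rw [indicator_of_notMem hs]
    by_cases h : p.2 ≤ s
    · have : (p.1, s) ∉ triangle T := fun h' => hs ⟨h, h'.2.1⟩
      simp [integrationKernel, indicator_of_notMem this]
    · simp [hκ.eq_zero (s, p.2) fun h' => h h'.2.1]

lemma integrationOp_eq (hω : IsWeight T ω) :
    integrationOp r T =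
      -Complex.I • (isDominatedKernel_integrationKernel (r := r) hω).op hω := by
  ext1 f
  ext1
  filter_upwards [coeFn_integrationOp f, (isDominatedKernel_integrationKernel hω).coeFn_op hω f,
    Lp.coeFn_smul (-Complex.I) ((isDominatedKernel_integrationKernel hω).op hω f),
    ae_restrict_mem measurableSet_Ioc] with x h1 h2 h3 hx
  rw [h1, smul_apply, h3, Pi.smul_apply, h2, intervalIntegral.integral_of_le hx.1.le]
  congr 1
  have : (fun t => integrationKernel r T (x, t) (f t)) = (Ioc 0 x).indicator fun t => f t := by
    funext t
    by_cases ht : t ∈ Ioc 0 x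
    · have : (x, t) ∈ triangle T := ⟨ht.1, ht.2, hx.2⟩
      simp [indicator_of_mem ht, integrationKernel, indicator_of_mem this]
    · have : (x, t) ∉ triangle T := fun h => ht ⟨h.1, h.2.1⟩
      simp [indicator_of_notMem ht, integrationKernel, indicator_of_notMem this]
  rw [this, integral_indicator measurableSet_Ioc, Measure.restrict_restrict measurableSet_Ioc,
    inter_eq_left.2 (Ioc_subset_Ioc_right hx.2)]

/-- The transformation operator `1 + κ` intertwines integration with a Volterra perturbation. -/
lemma op_comp_integrationOp_sub (hω : IsWeight T ω) (hM : IsDominatedKernel T ω M)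
    (hκ : IsDominatedKernel T ω κ)
    (h : κ = (triangle T).indicator (diagonalIntegral M)) :
    hκ.op hω * integrationOp r T - integrationOp r T * hκ.op hω =
      Complex.I • (integrationOp r T * hM.op hω * integrationOp r T) := by
  have hJ := isDominatedKernel_integrationKernel (r := r) hω
  -- With `J` the operator `∫₀ˣ · dt`, the diagonal identity says `κ J = J κ + J M J` at the level
  -- of kernels. Substituting `A = -i J` produces the factor `i`.
  have hk : kernelComp κ (integrationKernel r T) =
      kernelComp (integrationKernel r T) κ +
        kernelComp (integrationKernel r T) (kernelComp M (integrationKernel r T)) := by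
    funext p
    by_cases hp : p ∈ triangle T
    · rw [Pi.add_apply, hκ.kernelComp_integrationKernel hp,
        hκ.kernelComp_integrationKernel_left hp,
        (hM.comp hω hJ).kernelComp_integrationKernel_left hp, ← sub_eq_iff_eq_add',
        hM.integral_diagonalIntegral_sub hω h hp.1.le hp.2.2]
      refine setIntegral_congr_fun measurableSet_Ioc fun s hs => ?_
      exact (hM.kernelComp_integrationKernel (p := (s, p.2))
        ⟨hp.1, hs.1.le, hs.2.trans hp.2.2⟩).symm
    · rw [Pi.add_apply, (hκ.comp hω hJ).eq_zero p hp, (hJ.comp hω hκ).eq_zero p hp,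
        (hJ.comp hω (hM.comp hω hJ)).eq_zero p hp, add_zero]
  have hop := op_congr hω (hκ.comp hω hJ) ((hJ.comp hω hκ).add (hJ.comp hω (hM.comp hω hJ))) hk
  rw [op_add hω (hJ.comp hω hκ) (hJ.comp hω (hM.comp hω hJ)), op_comp hω hκ hJ, op_comp hω hJ hκ,
    op_comp hω hJ (hM.comp hω hJ), op_comp hω hM hJ] at hop
  change hκ.op hω * hJ.op hω = hJ.op hω * hκ.op hω + hJ.op hω * (hM.op hω * hJ.op hω) at hop
  rw [integrationOp_eq hω]
  simp only [mul_smul_comm, smul_mul_assoc, hop, smul_add, smul_smul, mul_assoc]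
  rw [add_sub_cancel_left]
  congr 1
  simp

/-- The case `t = 0` of the diagonal identity: since `κ(s, 0) = 0`, one side integral drops out and
`∫ κ(x, s) ds` becomes a double integral of `M`. -/
lemma op_const_eq (hω : IsWeight T ω) (hM : IsDominatedKernel T ω M)
    (hκ : IsDominatedKernel T ω κ) (h : κ = (triangle T).indicator (diagonalIntegral M))
    (c : EuclideanSpace ℂ (Fin r)) :
    hκ.op hω (Lp.const 2 (intervalMeasure T) c) =
      Complex.I • integrationOp r T (hM.op hω (Lp.const 2 (intervalMeasure T) c)) := by
  have hslice {m : ℝ × ℝ → Op r} (hm : IsDominatedKernel T ω m) (x : ℝ) :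
      ∫ t, m (x, t) = ∫ t in Ioc 0 x, m (x, t) :=
    (setIntegral_eq_integral_of_forall_compl_eq_zero (s := Ioc 0 x) fun t ht =>
      hm.eq_zero _ fun h => ht ⟨h.1, h.2.1⟩).symm
  have hint : Integrable fun s => ∫ t, M (s, t) := (hM.integrable hω).integral_prod_left
  ext1
  filter_upwards [hκ.op_const hω c,
    coeFn_integrationOp (hM.op hω (Lp.const 2 (intervalMeasure T) c)),
    Lp.coeFn_smul Complex.I (integrationOp r T (hM.op hω (Lp.const 2 (intervalMeasure T) c))),
    ae_restrict_mem measurableSet_Ioc] with x h1 h2 h3 hx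
  rw [h1, h3, Pi.smul_apply, h2, smul_smul, mul_neg, Complex.I_mul_I, neg_neg, one_smul, hslice hκ]
  have h4 := hM.integral_diagonalIntegral_sub hω h le_rfl hx.2
  have h5 : ∫ s in Ioc 0 x, κ (s, 0) = 0 :=
    setIntegral_eq_zero_of_forall_eq_zero fun s _ => hκ.eq_zero _ fun h => lt_irrefl _ h.1
  rw [h5, sub_zero] at h4
  simp only [← hslice hM] at h4
  rw [h4, ContinuousLinearMap.integral_apply hint.integrableOn,
    intervalIntegral.integral_of_le hx.1.le]
  refine integral_congr_ae ?_
  have h6 := ae_mono (Measure.restrict_mono (Ioc_subset_Ioc_right hx.2) le_rfl)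
    (hM.op_const hω c)
  filter_upwards [h6] with s hs
  exact hs.symm

end IsDominatedKernel

/-! ### The kernel built from the potential -/

variable {m₁ m₂ : ℕ} {T : ℝ} {v : ℝ → Matrix (Fin m₁) (Fin m₂) ℂ}

/-- A measurable square-summable potential which vanishes off `(0, T]`. -/
structure IsRegularPotential (T : ℝ) (v : ℝ → Matrix (Fin m₁) (Fin m₂) ℂ) : Prop where
  measurable : ∀ a b, Measurable fun x => v x a b
  eq_zero : ∀ x ∉ Ioc 0 T, v x = 0
  memLp : ∀ a b, MemLp (fun x => v x a b) 2 volume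

/-- A measurable representative makes the potential kernel strongly measurable on the whole plane.
The Dirac system holds almost everywhere, so `u` remains its solution. -/
lemma SquareSummable.exists_isRegularPotential (hv : SquareSummable T v) :
    ∃ w, IsRegularPotential T w ∧ ∀ᵐ x ∂(intervalMeasure T), v x = w x := by
  set w : ℝ → Matrix (Fin m₁) (Fin m₂) ℂ := fun x => Matrix.of fun a b =>
    (Ioc 0 T).indicator ((hv a b).1.mk _) x with hw
  have hae (a b) : (fun x => v x a b) =ᵐ[intervalMeasure T] (hv a b).1.mk _ := (hv a b).1.ae_eq_mk
  refine ⟨w, ⟨fun a b => ?_, fun x hx => ?_, fun a b => ?_⟩, ?_⟩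
  · exact (hv a b).1.stronglyMeasurable_mk.measurable.indicator measurableSet_Ioc
  · ext a b
    exact indicator_of_notMem hx _
  · exact (memLp_indicator_iff_restrict measurableSet_Ioc).2 ((hv a b).ae_eq (hae a b))
  · filter_upwards [ae_all_iff.2 fun a => ae_all_iff.2 fun b => hae a b,
      ae_restrict_mem measurableSet_Ioc] with x hx hm
    ext a b
    simp only [hw, Matrix.of_apply, indicator_of_mem hm]
    exact hx a b

/-- A weight which dominates the entries of the potential. -/
def potentialWeight (T : ℝ) (v : ℝ → Matrix (Fin m₁) (Fin m₂) ℂ) : ℝ → ℝ :=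
  (Ioc 0 T).indicator fun x => 1 + ∑ a, ∑ b, ‖v x a b‖

/-- The kernel `v(x)* v(t)` on the triangle. -/
def potentialKernel (T : ℝ) (v : ℝ → Matrix (Fin m₁) (Fin m₂) ℂ) : ℝ × ℝ → Op m₂ :=
  (triangle T).indicator fun p => Matrix.toEuclideanCLM (𝕜 := ℂ) ((v p.1)ᴴ * v p.2)

namespace IsRegularPotential

lemma isWeight (hv : IsRegularPotential T v) : IsWeight T (potentialWeight T v) := by
  have hsum (x : ℝ) : 0 ≤ ∑ a, ∑ b, ‖v x a b‖ :=
    Finset.sum_nonneg fun a _ => Finset.sum_nonneg fun b _ => norm_nonneg _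
  refine ⟨?_, fun x hx => ?_, fun x hx => indicator_of_notMem hx _, ?_⟩
  · refine Measurable.indicator (measurable_const.add ?_) measurableSet_Ioc
    exact Finset.measurable_fun_sum _ fun a _ => Finset.measurable_fun_sum _ fun b _ =>
      (hv.measurable a b).norm
  · rw [potentialWeight, indicator_of_mem hx]
    linarith [hsum x]
  · have h : MemLp (fun x => ∑ a, ∑ b, ‖v x a b‖) 2 (intervalMeasure T) :=
      memLp_finsetSum _ fun a _ => memLp_finsetSum _ fun b _ => ((hv.memLp a b).restrict _).norm
    have h1 : MemLp (fun _ : ℝ => (1 : ℝ)) 2 (intervalMeasure T) := memLp_const 1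
    exact (memLp_indicator_iff_restrict measurableSet_Ioc).2 (h1.add h)

lemma norm_le_potentialWeight (hv : IsRegularPotential T v) (x : ℝ) (a : Fin m₁) (b : Fin m₂) :
    ‖v x a b‖ ≤ potentialWeight T v x := by
  by_cases hx : x ∈ Ioc 0 T
  · rw [potentialWeight, indicator_of_mem hx]
    have h1 : ‖v x a b‖ ≤ ∑ b, ‖v x a b‖ := Finset.single_le_sum (f := fun b => ‖v x a b‖)
      (fun b _ => norm_nonneg _) (Finset.mem_univ b)
    have h2 : ∑ b, ‖v x a b‖ ≤ ∑ a, ∑ b, ‖v x a b‖ :=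
      Finset.single_le_sum (f := fun a => ∑ b, ‖v x a b‖)
        (fun a _ => Finset.sum_nonneg fun b _ => norm_nonneg _) (Finset.mem_univ a)
    linarith
  · rw [hv.eq_zero x hx, potentialWeight, indicator_of_notMem hx]
    simp

lemma isDominatedKernel (hv : IsRegularPotential T v) :
    IsDominatedKernel T (potentialWeight T v) (potentialKernel T v) := by
  have hω := hv.isWeight
  let L := (Matrix.toEuclideanCLM (n := Fin m₂) (𝕜 := ℂ)).toAlgEquiv.toLinearMap
  have hL (A : Matrix (Fin m₂) (Fin m₂) ℂ) : Matrix.toEuclideanCLM (𝕜 := ℂ) A =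
      ∑ a, ∑ b, A a b • L (Matrix.single a b (1 : ℂ)) := by
    conv_lhs => rw [Matrix.matrix_eq_sum_single A]
    simp only [map_sum]
    refine Finset.sum_congr rfl fun a _ => Finset.sum_congr rfl fun b _ => ?_
    rw [← map_smul, Matrix.smul_single, smul_eq_mul, mul_one]
    rfl
  have hentry (p : ℝ × ℝ) (a b : Fin m₂) :
      ((v p.1)ᴴ * v p.2) a b = ∑ c, star (v p.1 c a) * v p.2 c b := by
    simp [Matrix.mul_apply]
  refine ⟨?_, fun p hp => indicator_of_notMem hp _,
    -- Each entry of `v(x)* v(t)` is a sum of `m₁` products, each at most `ω(x) ω(t)`.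
    ∑ a : Fin m₂, ∑ b : Fin m₂, m₁ * ‖L (Matrix.single a b (1 : ℂ))‖, ?_, fun p => ?_⟩
  · refine StronglyMeasurable.indicator ?_ (measurableSet_triangle T)
    simp only [hL, hentry]
    refine Finset.stronglyMeasurable_fun_sum _ fun a _ =>
      Finset.stronglyMeasurable_fun_sum _ fun b _ => StronglyMeasurable.smul_const ?_ _
    refine Measurable.stronglyMeasurable (Finset.measurable_fun_sum _ fun c _ => ?_)
    exact (continuous_star.measurable.comp ((hv.measurable c a).comp measurable_fst)).mul
      ((hv.measurable c b).comp measurable_snd)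
  · exact Finset.sum_nonneg fun a _ => Finset.sum_nonneg fun b _ =>
      mul_nonneg (Nat.cast_nonneg _) (norm_nonneg _)
  · refine (norm_indicator_le_norm_self _ _).trans ?_
    rw [hL, Finset.sum_mul]
    refine norm_sum_le_of_le _ fun a _ => ?_
    rw [Finset.sum_mul]
    refine norm_sum_le_of_le _ fun b _ => ?_
    rw [norm_smul, hentry]
    have : ‖∑ c, star (v p.1 c a) * v p.2 c b‖ ≤
        m₁ * (potentialWeight T v p.1 * potentialWeight T v p.2) := by
      refine (norm_sum_le_of_le _ (f := fun c => star (v p.1 c a) * v p.2 c b)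
        (n := fun _ => potentialWeight T v p.1 * potentialWeight T v p.2)
        fun c _ => ?_).trans_eq (by simp)
      rw [norm_mul, norm_star]
      exact mul_le_mul (hv.norm_le_potentialWeight _ _ _) (hv.norm_le_potentialWeight _ _ _)
        (norm_nonneg _) (hω.nonneg _)
    refine (mul_le_mul_of_nonneg_right this (norm_nonneg _)).trans_eq ?_
    ring

/-- The operator with the kernel `v(x)* v(t)`. -/
def op (hv : IsRegularPotential T v) : L2 m₂ T →L[ℂ] L2 m₂ T :=
  hv.isDominatedKernel.op hv.isWeight

lemma integrable_apply (hv : IsRegularPotential T v) (f : L2 m₂ T) (c : Fin m₁) :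
    Integrable (fun t => (v t *ᵥ (f t).ofLp) c) (intervalMeasure T) := by
  simp only [Matrix.mulVec, dotProduct]
  refine integrable_finsetSum _ fun l _ => ?_
  exact ((hv.memLp c l).restrict _).integrable_mul (memLp_piLp_iff.1 (Lp.memLp f) l)

lemma coeFn_op (hv : IsRegularPotential T v) (f : L2 m₂ T) :
    ∀ᵐ x ∂(intervalMeasure T), ∀ k, hv.op f x k =
      ∑ c, star (v x c k) * ∫ t in (0 : ℝ)..x, (v t *ᵥ (f t).ofLp) c := by
  filter_upwards [hv.isDominatedKernel.coeFn_op hv.isWeight f,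
    ae_restrict_mem measurableSet_Ioc] with x h1 hx k
  have hi := hv.isDominatedKernel.integrable_apply hv.isWeight f x
  rw [op, h1, eval_integral_piLp (integrable_piLp_iff.1 hi)]
  have h2 (t : ℝ) : potentialKernel T v (x, t) (f t) k =
      (Ioc 0 x).indicator (fun t => ∑ c, star (v x c k) * (v t *ᵥ (f t).ofLp) c) t := by
    by_cases ht : t ∈ Ioc 0 x
    · have htT : (x, t) ∈ triangle T := ⟨ht.1, ht.2, hx.2⟩
      rw [potentialKernel, indicator_of_mem htT, indicator_of_mem ht, Matrix.ofLp_toEuclideanCLM,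
        ← Matrix.mulVec_mulVec]
      simp [Matrix.mulVec, dotProduct]
    · have htT : (x, t) ∉ triangle T := fun h => ht ⟨h.1, h.2.1⟩
      rw [potentialKernel, indicator_of_notMem htT, indicator_of_notMem ht]
      rfl
  simp only [h2]
  rw [integral_indicator measurableSet_Ioc, Measure.restrict_restrict measurableSet_Ioc,
    inter_eq_left.2 (Ioc_subset_Ioc_right hx.2), integral_finsetSum]
  · simp only [integral_const_mul, intervalIntegral.integral_of_le hx.1.le]
  · exact fun c _ => ((hv.integrable_apply f c).mono_measure
      (Measure.restrict_mono (Ioc_subset_Ioc_right hx.2) le_rfl)).const_mul _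

end IsRegularPotential

/-! ### Solutions of the Dirac system at `z = 0` -/

variable {m₁ m₂ : ℕ} {T : ℝ} {v : ℝ → Matrix (Fin m₁) (Fin m₂) ℂ}

/-- The diagonal of the signature matrix. -/
def signDiag (m₁ m₂ : ℕ) : Fin m₁ ⊕ Fin m₂ → ℂ := Sum.elim (fun _ => 1) fun _ => -1

lemma signature_eq_diagonal : signature m₁ m₂ = Matrix.diagonal (signDiag m₁ m₂) := by
  rw [signature, signDiag, ← Matrix.fromBlocks_diagonal]
  congr
  rw [← Matrix.diagonal_one, Matrix.diagonal_neg]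

lemma signature_mul_self : signature m₁ m₂ * signature m₁ m₂ = 1 := by
  simp [signature, Matrix.fromBlocks_multiply]

/-- `y` is an absolutely continuous solution of the system `y' = i j V y + [0; h]`. -/
structure IsSolution (T : ℝ) (v : ℝ → Matrix (Fin m₁) (Fin m₂) ℂ) (h : ℝ → Fin m₂ → ℂ)
    (y : ℝ → Fin m₁ ⊕ Fin m₂ → ℂ) : Prop where
  absolutelyContinuous : ∀ a, AbsolutelyContinuousOnInterval (fun x => y x a) 0 T
  hasDerivAt_inl : ∀ᵐ x ∂(intervalMeasure T), ∀ c, HasDerivAt (fun s => y s (Sum.inl c))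
    (Complex.I * (v x *ᵥ fun k => y x (Sum.inr k)) c) x
  hasDerivAt_inr : ∀ᵐ x ∂(intervalMeasure T), ∀ k, HasDerivAt (fun s => y s (Sum.inr k))
    (-Complex.I * ((v x)ᴴ *ᵥ fun c => y x (Sum.inl c)) k + h x k) x

lemma IsFundamentalSolution.congr_ae {w : ℝ → Matrix (Fin m₁) (Fin m₂) ℂ} {z : ℂ}
    {u : ℝ → Matrix (Fin m₁ ⊕ Fin m₂) (Fin m₁ ⊕ Fin m₂) ℂ}
    (hu : IsFundamentalSolution T v z u) (h : ∀ᵐ x ∂(intervalMeasure T), v x = w x) :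
    IsFundamentalSolution T w z u := by
  refine ⟨hu.absolutelyContinuous, ?_, hu.initial⟩
  filter_upwards [hu.hasDerivAt, h] with x h1 h2
  rw [fullPotential, ← h2]
  exact h1

lemma IsFundamentalSolution.isSolution {u : ℝ → Matrix (Fin m₁ ⊕ Fin m₂) (Fin m₁ ⊕ Fin m₂) ℂ}
    (hu : IsFundamentalSolution T v 0 u) (e : Fin m₁ ⊕ Fin m₂) :
    IsSolution T v 0 fun x a => u x a e := by
  refine ⟨fun a => hu.absolutelyContinuous a e, ?_, ?_⟩
  · filter_upwards [hu.hasDerivAt] with x hx c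
    convert hx (Sum.inl c) e using 1
    simp [signature, fullPotential, Matrix.fromBlocks_multiply, Matrix.mul_apply, Matrix.mulVec,
      dotProduct]
  · filter_upwards [hu.hasDerivAt] with x hx k
    convert hx (Sum.inr k) e using 1
    simp [signature, fullPotential, Matrix.fromBlocks_multiply, Matrix.mul_apply, Matrix.mulVec,
      dotProduct]

/-- The indefinite inner product of `ℂ^{m₁ + m₂}`. -/
def signForm (y w : Fin m₁ ⊕ Fin m₂ → ℂ) : ℂ := ∑ a, star (y a) * (signDiag m₁ m₂ a * w a)

namespace IsSolution

variable {g h : ℝ → Fin m₂ → ℂ} {y w : ℝ → Fin m₁ ⊕ Fin m₂ → ℂ}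

/-- The potential terms cancel because `(i j V)* j + j (i j V) = -i V + i V = 0`. Only the source
survives, with the sign `-1` that `j` has on the lower block. -/
lemma hasDerivAt_signForm (hy : IsSolution T v 0 y) (hw : IsSolution T v h w) :
    ∀ᵐ x ∂(intervalMeasure T), HasDerivAt (fun s => signForm (y s) (w s))
      (-∑ k, star (y x (Sum.inr k)) * h x k) x := by
  filter_upwards [hy.hasDerivAt_inl, hy.hasDerivAt_inr, hw.hasDerivAt_inl, hw.hasDerivAt_inr]
    with x h1 h2 h3 h4
  have h5 : HasDerivAt (fun s => signForm (y s) (w s))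
      ((∑ c, (star (Complex.I * (v x *ᵥ fun k => y x (Sum.inr k)) c) *
          (signDiag m₁ m₂ (Sum.inl c) * w x (Sum.inl c)) +
        star (y x (Sum.inl c)) * (signDiag m₁ m₂ (Sum.inl c) *
          (Complex.I * (v x *ᵥ fun k => w x (Sum.inr k)) c)))) +
      ∑ k, (star (-Complex.I * ((v x)ᴴ *ᵥ fun c => y x (Sum.inl c)) k + (0 : ℝ → Fin m₂ → ℂ) x k) *
          (signDiag m₁ m₂ (Sum.inr k) * w x (Sum.inr k)) +
        star (y x (Sum.inr k)) * (signDiag m₁ m₂ (Sum.inr k) *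
          (-Complex.I * ((v x)ᴴ *ᵥ fun c => w x (Sum.inl c)) k + h x k)))) x := by
    simp only [signForm, Fintype.sum_sum_type]
    exact (HasDerivAt.fun_sum fun c _ => (h1 c).star.mul ((h3 c).const_mul _)).add
      (HasDerivAt.fun_sum fun k _ => (h2 k).star.mul ((h4 k).const_mul _))
  convert h5 using 1
  have e1 : ∑ c, star ((v x *ᵥ fun k => y x (Sum.inr k)) c) * w x (Sum.inl c) =
      ∑ k, star (y x (Sum.inr k)) * ((v x)ᴴ *ᵥ fun c => w x (Sum.inl c)) k := by
    change star (v x *ᵥ fun k => y x (Sum.inr k)) ⬝ᵥ (fun c => w x (Sum.inl c)) =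
      star (fun k => y x (Sum.inr k)) ⬝ᵥ ((v x)ᴴ *ᵥ fun c => w x (Sum.inl c))
    rw [Matrix.star_mulVec, Matrix.dotProduct_mulVec]
  have e2 : ∑ c, star (y x (Sum.inl c)) * (v x *ᵥ fun k => w x (Sum.inr k)) c =
      ∑ k, star (((v x)ᴴ *ᵥ fun c => y x (Sum.inl c)) k) * w x (Sum.inr k) := by
    change star (fun c => y x (Sum.inl c)) ⬝ᵥ (v x *ᵥ fun k => w x (Sum.inr k)) =
      star ((v x)ᴴ *ᵥ fun c => y x (Sum.inl c)) ⬝ᵥ (fun k => w x (Sum.inr k))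
    rw [Matrix.star_mulVec, Matrix.dotProduct_mulVec, Matrix.conjTranspose_conjTranspose]
  have e3 : ∑ c, (star (Complex.I * (v x *ᵥ fun k => y x (Sum.inr k)) c) *
          (signDiag m₁ m₂ (Sum.inl c) * w x (Sum.inl c)) +
        star (y x (Sum.inl c)) * (signDiag m₁ m₂ (Sum.inl c) *
          (Complex.I * (v x *ᵥ fun k => w x (Sum.inr k)) c))) =
      -Complex.I * (∑ c, star ((v x *ᵥ fun k => y x (Sum.inr k)) c) * w x (Sum.inl c)) +
      Complex.I * ∑ c, star (y x (Sum.inl c)) * (v x *ᵥ fun k => w x (Sum.inr k)) c := by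
    rw [Finset.mul_sum, Finset.mul_sum, ← Finset.sum_add_distrib]
    refine Finset.sum_congr rfl fun c _ => ?_
    simp only [signDiag, Sum.elim_inl, star_mul', Complex.star_def, Complex.conj_I]
    ring
  have e4 : ∑ k, (star (-Complex.I * ((v x)ᴴ *ᵥ fun c => y x (Sum.inl c)) k +
          (0 : ℝ → Fin m₂ → ℂ) x k) *
          (signDiag m₁ m₂ (Sum.inr k) * w x (Sum.inr k)) +
        star (y x (Sum.inr k)) * (signDiag m₁ m₂ (Sum.inr k) *
          (-Complex.I * ((v x)ᴴ *ᵥ fun c => w x (Sum.inl c)) k + h x k))) =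
      -Complex.I * (∑ k, star (((v x)ᴴ *ᵥ fun c => y x (Sum.inl c)) k) * w x (Sum.inr k)) +
      Complex.I * (∑ k, star (y x (Sum.inr k)) * ((v x)ᴴ *ᵥ fun c => w x (Sum.inl c)) k) -
      ∑ k, star (y x (Sum.inr k)) * h x k := by
    rw [Finset.mul_sum, Finset.mul_sum, ← Finset.sum_add_distrib, ← Finset.sum_sub_distrib]
    refine Finset.sum_congr rfl fun c _ => ?_
    simp only [signDiag, Sum.elim_inr, Pi.zero_apply, add_zero, star_mul', star_neg,
      Complex.star_def, Complex.conj_I]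
    ring
  rw [e3, e4, e1, e2]
  ring

lemma absolutelyContinuous_signForm (hy : IsSolution T v g y) (hw : IsSolution T v h w) :
    AbsolutelyContinuousOnInterval (fun s => signForm (y s) (w s)) 0 T :=
  absolutelyContinuousOnInterval_sum _ fun a _ =>
    (absolutelyContinuousOnInterval_star (hy.absolutelyContinuous a)).fun_smul
      ((hw.absolutelyContinuous a).const_smul (signDiag m₁ m₂ a))

lemma signForm_eq_sub_integral (hT : 0 ≤ T) (hy : IsSolution T v 0 y) (hw : IsSolution T v h w)
    (hh : ∀ k, IntervalIntegrable (fun x => h x k) volume 0 T) {x : ℝ} (hx : x ∈ Icc 0 T) :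
    signForm (y x) (w x) = signForm (y 0) (w 0) -
      ∫ t in (0 : ℝ)..x, ∑ k, star (y t (Sum.inr k)) * h t k := by
  have hi : IntervalIntegrable (fun t => -∑ k, star (y t (Sum.inr k)) * h t k) volume 0 T := by
    have hs : IntervalIntegrable (∑ k, fun t => star (y t (Sum.inr k)) * h t k) volume 0 T :=
      IntervalIntegrable.sum _ fun k _ => (hh k).continuousOn_mul
        (absolutelyContinuousOnInterval_star (hy.absolutelyContinuous _)).continuousOn
    convert hs.neg using 1
    funext t
    simp
  rw [eq_add_integral_of_absolutelyContinuous hT (hy.absolutelyContinuous_signForm hw)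
    (hy.hasDerivAt_signForm hw) hi hx, intervalIntegral.integral_neg, sub_eq_add_neg]

end IsSolution

namespace IsFundamentalSolution

variable {u : ℝ → Matrix (Fin m₁ ⊕ Fin m₂) (Fin m₁ ⊕ Fin m₂) ℂ}

/-- Constancy of the form along columns of `u` gives `u* j u = j`. Hence `j u* j` is a left inverse
of the square matrix `u`, so also a right inverse. -/
lemma mul_signature_mul_conjTranspose (hT : 0 ≤ T) (hu : IsFundamentalSolution T v 0 u) {x : ℝ}
    (hx : x ∈ Icc 0 T) : u x * signature m₁ m₂ * (u x)ᴴ = signature m₁ m₂ := by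
  have hentry (s : ℝ) (b e : Fin m₁ ⊕ Fin m₂) : ((u s)ᴴ * signature m₁ m₂ * u s) b e =
      signForm (fun a => u s a b) (fun a => u s a e) := by
    rw [signature_eq_diagonal, Matrix.mul_assoc]
    simp [signForm, Matrix.mul_apply (M := (u s)ᴴ), Matrix.diagonal_mul]
  have h1 : (u x)ᴴ * signature m₁ m₂ * u x = signature m₁ m₂ := by
    ext b e
    rw [hentry, (hu.isSolution b).signForm_eq_sub_integral hT (hu.isSolution e) (by simp) hx,
      ← hentry, hu.initial]
    simp
  have h2 : signature m₁ m₂ * (u x)ᴴ * signature m₁ m₂ * u x = 1 := by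
    rw [Matrix.mul_assoc, Matrix.mul_assoc, ← Matrix.mul_assoc (u x)ᴴ, h1, signature_mul_self]
  have h3 := mul_eq_one_comm.1 h2
  calc u x * signature m₁ m₂ * (u x)ᴴ
      = u x * (signature m₁ m₂ * (u x)ᴴ * signature m₁ m₂) * signature m₁ m₂ := by
        simp only [Matrix.mul_assoc, signature_mul_self, Matrix.mul_one]
    _ = signature m₁ m₂ := by rw [h3, Matrix.one_mul]

lemma coeFn_diracOp (hT : 0 < T) (hu : IsFundamentalSolution T v 0 u) (f : L2 m₂ T) :
    ∀ᵐ x ∂(intervalMeasure T), ∀ k, diracOp hT hu f x k =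
      ∑ e, u x (Sum.inr k) e * signDiag m₁ m₂ e *
        (Complex.I * ∫ t in (0 : ℝ)..x, ∑ l, star (u t (Sum.inr l) e) * f t l) := by
  filter_upwards [coeFn_volterraOp (diracKernel u) (hu.isHilbertSchmidtKernel hT) f,
    ae_integrable_volterra (hu.isHilbertSchmidtKernel hT) f, ae_restrict_mem measurableSet_Ioc]
    with x h1 hi hx k
  rw [diracOp, h1, volterraFun_eq _ _ hx, eval_integral_piLp (integrable_piLp_iff.1 hi)]
  have h2 (t : ℝ) : extKernel T (diracKernel u) (x, t) (f t) k =
      (Ioc 0 x).indicator (fun t => ∑ e, u x (Sum.inr k) e * signDiag m₁ m₂ e *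
        (Complex.I * ∑ l, star (u t (Sum.inr l) e) * f t l)) t := by
    by_cases ht : t ∈ Ioc 0 x
    · have htT : (x, t) ∈ triangle T := ⟨ht.1, ht.2, hx.2⟩
      rw [extKernel, indicator_of_mem htT, indicator_of_mem ht, Matrix.ofLp_toEuclideanCLM,
        diracKernel, Matrix.smul_mulVec, ← Matrix.mulVec_mulVec, signature_eq_diagonal]
      simp only [Pi.smul_apply, smul_eq_mul, Matrix.mulVec, dotProduct, Matrix.mul_diagonal,
        lowerBlockRow_apply, Matrix.conjTranspose_apply, Finset.mul_sum]
      refine Finset.sum_congr rfl fun e _ => Finset.sum_congr rfl fun l _ => ?_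
      ring
    · have htT : (x, t) ∉ triangle T := fun h => ht ⟨h.1, h.2.1⟩
      rw [extKernel, indicator_of_notMem htT, indicator_of_notMem ht, map_zero]
      rfl
  have hint (e : Fin m₁ ⊕ Fin m₂) :
      IntegrableOn (fun t => ∑ l, star (u t (Sum.inr l) e) * f t l) (Ioc 0 x) := by
    refine IntegrableOn.mono_set (t := Ioc 0 T) ?_ (Ioc_subset_Ioc_right hx.2)
    refine integrable_finsetSum _ fun l _ => ?_
    have hl : IntervalIntegrable (fun t => f t l) volume 0 T := by
      rw [intervalIntegrable_iff_integrableOn_Ioc_of_le hT.le]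
      exact (memLp_piLp_iff.1 (Lp.memLp f) l).integrable (by norm_num)
    exact (intervalIntegrable_iff_integrableOn_Ioc_of_le hT.le).1 (hl.continuousOn_mul
      (absolutelyContinuousOnInterval_star (hu.absolutelyContinuous (Sum.inr l) e)).continuousOn)
  simp only [h2]
  rw [integral_indicator measurableSet_Ioc, Measure.restrict_restrict measurableSet_Ioc,
    inter_eq_left.2 (Ioc_subset_Ioc_right hx.2), integral_finsetSum]
  · simp only [integral_const_mul, intervalIntegral.integral_of_le hx.1.le]
  · exact fun e _ => ((hint e).const_mul _).const_mul _

end IsFundamentalSolution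

lemma coeFn_integrationOp_apply {r : ℕ} (f : L2 r T) :
    ∀ᵐ x ∂(intervalMeasure T), ∀ k, integrationOp r T f x k =
      -Complex.I * ∫ t in (0 : ℝ)..x, f t k := by
  filter_upwards [coeFn_integrationOp f, ae_restrict_mem measurableSet_Ioc] with x h1 hx k
  have hi : Integrable f (volume.restrict (Ioc 0 x)) :=
    ((Lp.memLp f).integrable (by norm_num)).mono_measure
      (Measure.restrict_mono (Ioc_subset_Ioc_right hx.2) le_rfl)
  rw [h1, PiLp.smul_apply, smul_eq_mul, intervalIntegral.integral_of_le hx.1.le,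
    intervalIntegral.integral_of_le hx.1.le, eval_integral_piLp (integrable_piLp_iff.1 hi)]

/-! ### The relation between `K` and `A`, and the equation for `γ₂` -/

namespace IsFundamentalSolution

variable {u : ℝ → Matrix (Fin m₁ ⊕ Fin m₂) (Fin m₁ ⊕ Fin m₂) ℂ}

/-- `A = K (1 - i Q A)`, that is, the inverse of `K` is `A⁻¹ - i Q`. -/
lemma diracOp_mul_one_sub (hT : 0 < T) (hu : IsFundamentalSolution T v 0 u)
    (hv : IsRegularPotential T v) :
    diracOp hT hu * (1 - Complex.I • (hv.op * integrationOp m₂ T)) = integrationOp m₂ T := by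
  ext1 g
  set A := integrationOp m₂ T
  set H : L2 m₂ T := g - Complex.I • hv.op (A g)
  change diracOp hT hu H = A g
  -- `P` has lower block `A g` and upper block `i ∫ v A g`. It starts at zero and solves the Dirac
  -- system with source `-i H`, since `v*` times the upper block is `i Q A g`.
  set P : ℝ → Fin m₁ ⊕ Fin m₂ → ℂ := fun x => Sum.elim
    (fun c => Complex.I * ∫ t in (0 : ℝ)..x, (v t *ᵥ (A g t).ofLp) c)
    (fun k => -Complex.I * ∫ t in (0 : ℝ)..x, g t k) with hP
  have hi1 (c : Fin m₁) : IntervalIntegrable (fun t => (v t *ᵥ (A g t).ofLp) c) volume 0 T :=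
    (intervalIntegrable_iff_integrableOn_Ioc_of_le hT.le).2 (hv.integrable_apply (A g) c)
  have hi2 (f : L2 m₂ T) (k : Fin m₂) : IntervalIntegrable (fun t => f t k) volume 0 T := by
    rw [intervalIntegrable_iff_integrableOn_Ioc_of_le hT.le]
    exact (memLp_piLp_iff.1 (Lp.memLp f) k).integrable (by norm_num)
  have hAg := coeFn_integrationOp_apply g
  have hsol : IsSolution T v (fun x k => -Complex.I * H x k) P := by
    refine ⟨?_, ?_, ?_⟩
    · rintro (c | k)
      · exact (absolutelyContinuousOnInterval_integral (hi1 c)).const_smul Complex.I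
      · exact (absolutelyContinuousOnInterval_integral (hi2 g k)).const_smul (-Complex.I)
    · filter_upwards [ae_all_iff.2 fun c => ae_hasDerivAt_integral hT.le (hi1 c), hAg]
        with x h1 h2 c
      have h3 : (fun k => P x (Sum.inr k)) = (A g x).ofLp := by
        funext k
        exact (h2 k).symm
      rw [h3]
      exact (h1 c).const_mul Complex.I
    · filter_upwards [ae_all_iff.2 fun k => ae_hasDerivAt_integral hT.le (hi2 g k),
        hv.coeFn_op (A g), Lp.coeFn_sub g (Complex.I • hv.op (A g)),
        Lp.coeFn_smul Complex.I (hv.op (A g))] with x h1 h2 h3 h4 k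
      refine ((h1 k).const_mul (-Complex.I)).congr_deriv ?_
      have h5 : ((v x)ᴴ *ᵥ fun c => P x (Sum.inl c)) k = Complex.I * hv.op (A g) x k := by
        change ∑ c, (v x)ᴴ k c * P x (Sum.inl c) = _
        rw [h2 k, Finset.mul_sum]
        refine Finset.sum_congr rfl fun c _ => ?_
        simp only [hP, Sum.elim_inl, Matrix.conjTranspose_apply]
        ring
      have h6 : H x k = g x k - Complex.I * hv.op (A g) x k := by
        rw [h3, Pi.sub_apply, h4]
        rfl
      rw [h5, h6]
      ring
  have hP0 (y : Fin m₁ ⊕ Fin m₂ → ℂ) : signForm y (P 0) = 0 := by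
    refine Finset.sum_eq_zero fun a _ => ?_
    rcases a with c | k <;> simp [hP]
  ext1
  filter_upwards [hu.coeFn_diracOp hT H, hAg, ae_restrict_mem measurableSet_Ioc] with x h1 h2 hx
  have hxI : x ∈ Icc 0 T := Ioc_subset_Icc_self hx
  ext k
  rw [h1, h2]
  -- The form between the columns of `u` and `P` integrates the source: `u* j P = i ∫ γ* H`.
  -- Multiplying by `γ j` gives `K H` on the left and, by `u j u* = j`, the lower block of `P` on
  -- the right.
  have h3 (e : Fin m₁ ⊕ Fin m₂) :
      Complex.I * (∫ t in (0 : ℝ)..x, ∑ l, star (u t (Sum.inr l) e) * H t l) =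
        ((u x)ᴴ *ᵥ (signature m₁ m₂ *ᵥ P x)) e := by
    have h4 := (hu.isSolution e).signForm_eq_sub_integral hT.le hsol
      (fun k => (hi2 H k).const_mul _) hxI
    rw [hP0, zero_sub] at h4
    have h5 : ((u x)ᴴ *ᵥ (signature m₁ m₂ *ᵥ P x)) e = signForm (fun a => u x a e) (P x) := by
      rw [signature_eq_diagonal]
      change ∑ a, star (u x a e) * (Matrix.diagonal (signDiag m₁ m₂) *ᵥ P x) a = _
      simp only [Matrix.mulVec_diagonal]
      rfl
    rw [h5, h4, ← intervalIntegral.integral_const_mul, ← intervalIntegral.integral_neg]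
    congr 1
    funext t
    rw [Finset.mul_sum, ← Finset.sum_neg_distrib]
    refine Finset.sum_congr rfl fun l _ => ?_
    ring
  simp only [h3]
  calc ∑ e, u x (Sum.inr k) e * signDiag m₁ m₂ e * ((u x)ᴴ *ᵥ (signature m₁ m₂ *ᵥ P x)) e
      = ((u x * signature m₁ m₂) *ᵥ ((u x)ᴴ *ᵥ (signature m₁ m₂ *ᵥ P x))) (Sum.inr k) := by
        rw [signature_eq_diagonal]
        change _ = ∑ e, (u x * Matrix.diagonal (signDiag m₁ m₂)) (Sum.inr k) e * _
        simp only [Matrix.mul_diagonal]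
    _ = P x (Sum.inr k) := by
        rw [Matrix.mulVec_mulVec, Matrix.mulVec_mulVec,
          hu.mul_signature_mul_conjTranspose hT.le hxI, signature_mul_self, Matrix.one_mulVec]

/-- The integral equation for the columns of the block `γ₂`. -/
lemma gammaTwoVec_eq (hT : 0 < T) (hu : IsFundamentalSolution T v 0 u)
    (hv : IsRegularPotential T v) (c : EuclideanSpace ℂ (Fin m₂)) :
    (hu.memLp_gammaTwoVec hT c).toLp (gammaTwoVec u c) =
      Lp.const 2 (intervalMeasure T) c +
        Complex.I • integrationOp m₂ T (hv.op
          ((hu.memLp_gammaTwoVec hT c).toLp (gammaTwoVec u c))) := by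
  set G : L2 m₂ T := (hu.memLp_gammaTwoVec hT c).toLp (gammaTwoVec u c)
  set A := integrationOp m₂ T
  have hG : G =ᵐ[intervalMeasure T] gammaTwoVec u c := MemLp.coeFn_toLp _
  have hγ (x : ℝ) (k : Fin m₂) : gammaTwoVec u c x k = ∑ l, u x (Sum.inr k) (Sum.inr l) * c l := by
    simp [gammaTwoVec, gammaTwo, Matrix.ofLp_toEuclideanCLM, Matrix.mulVec, dotProduct,
      lowerBlockRow_apply]
  set y : ℝ → Fin m₁ → ℂ := fun x a => ∑ l, u x (Sum.inl a) (Sum.inr l) * c l with hy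
  have hi2 (f : L2 m₂ T) (k : Fin m₂) : IntervalIntegrable (fun t => f t k) volume 0 T := by
    rw [intervalIntegrable_iff_integrableOn_Ioc_of_le hT.le]
    exact (memLp_piLp_iff.1 (Lp.memLp f) k).integrable (by norm_num)
  have hi1 (a : Fin m₁) : IntervalIntegrable (fun t => (v t *ᵥ (G t).ofLp) a) volume 0 T :=
    (intervalIntegrable_iff_integrableOn_Ioc_of_le hT.le).2 (hv.integrable_apply G a)
  have hac (b) : AbsolutelyContinuousOnInterval
      (fun x => ∑ l, u x b (Sum.inr l) * c l) 0 T :=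
    absolutelyContinuousOnInterval_sum _ fun l _ =>
      (hu.absolutelyContinuous b (Sum.inr l)).fun_smul (absolutelyContinuousOnInterval_const (c l))
  have hy1 (a : Fin m₁) : ∀ᵐ x ∂(intervalMeasure T),
      HasDerivAt (fun x => y x a) (Complex.I * (v x *ᵥ (G x).ofLp) a) x := by
    filter_upwards [ae_all_iff.2 fun l => (hu.isSolution (Sum.inr l)).hasDerivAt_inl, hG]
      with x h1 h2
    refine (HasDerivAt.fun_sum (u := Finset.univ) fun l _ =>
      (h1 l a).mul_const (c l)).congr_deriv ?_
    simp only [h2, Matrix.mulVec, dotProduct, hγ, Finset.mul_sum, Finset.sum_mul]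
    rw [Finset.sum_comm]
    refine Finset.sum_congr rfl fun l _ => Finset.sum_congr rfl fun k _ => ?_
    ring
  -- The upper block starts at zero, so it equals `i ∫ v γ₂ c`. Inserted in the equation for the
  -- lower block, it gives `(γ₂ c)' = Q γ₂ c`.
  have hyI (a : Fin m₁) {x : ℝ} (hx : x ∈ Icc 0 T) :
      y x a = Complex.I * ∫ t in (0 : ℝ)..x, (v t *ᵥ (G t).ofLp) a := by
    have h := eq_add_integral_of_absolutelyContinuous hT.le (hac (Sum.inl a)) (hy1 a)
      ((hi1 a).const_mul _) hx
    rw [intervalIntegral.integral_const_mul] at h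
    simpa [hu.initial] using h
  have hγd (k : Fin m₂) : ∀ᵐ x ∂(intervalMeasure T),
      HasDerivAt (fun x => ∑ l, u x (Sum.inr k) (Sum.inr l) * c l) (hv.op G x k) x := by
    filter_upwards [ae_all_iff.2 fun l => (hu.isSolution (Sum.inr l)).hasDerivAt_inr, hv.coeFn_op G,
      ae_restrict_mem measurableSet_Ioc] with x h1 h2 hx
    refine (HasDerivAt.fun_sum (u := Finset.univ) fun l _ =>
      (h1 l k).mul_const (c l)).congr_deriv ?_
    have h3 (a : Fin m₁) : ∫ t in (0 : ℝ)..x, (v t *ᵥ (G t).ofLp) a = -Complex.I * y x a := by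
      rw [hyI a (Ioc_subset_Icc_self hx), ← mul_assoc, neg_mul, Complex.I_mul_I, neg_neg, one_mul]
    rw [h2]
    simp only [h3]
    simp only [hy, Matrix.mulVec, dotProduct, Matrix.conjTranspose_apply, Finset.mul_sum,
      Finset.sum_mul, Pi.zero_apply, add_zero]
    rw [Finset.sum_comm]
    refine Finset.sum_congr rfl fun l _ => Finset.sum_congr rfl fun k _ => ?_
    ring
  ext1
  filter_upwards [hG, Lp.coeFn_add (Lp.const 2 (intervalMeasure T) c)
      (Complex.I • A (hv.op G)), Lp.coeFn_smul Complex.I (A (hv.op G)),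
    Lp.coeFn_const (μ := intervalMeasure T) (p := 2) c, coeFn_integrationOp_apply (hv.op G),
    ae_restrict_mem measurableSet_Ioc] with x h1 h2 h3 h4 h5 hx
  rw [h1, h2, Pi.add_apply, h3, h4, Pi.smul_apply]
  ext k
  rw [PiLp.add_apply, PiLp.smul_apply, h5, hγ,
    eq_add_integral_of_absolutelyContinuous hT.le (hac (Sum.inr k)) (hγd k) (hi2 _ k)
      (Ioc_subset_Icc_self hx), smul_eq_mul, ← mul_assoc, mul_neg, Complex.I_mul_I, neg_neg, one_mul]
  congr 1
  simp [hu.initial, Matrix.one_apply]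

end IsFundamentalSolution

/-! ### Invertibility of `1 + κ` for a bounded triangular kernel `κ` -/

namespace IsDominatedKernel

variable {r : ℕ} {T : ℝ} {ω : ℝ → ℝ} {κ : ℝ × ℝ → Op r}

lemma ae_norm_op_le (hω : IsWeight T ω) (hκ : IsDominatedKernel T ω κ) {C : ℝ}
    (hC : ∀ p, ‖κ p‖ ≤ C) (f : L2 r T) :
    ∀ᵐ x ∂(intervalMeasure T), ‖hκ.op hω f x‖ ≤ C * ∫ t in Ioc 0 x, ‖f t‖ := by
  filter_upwards [hκ.coeFn_op hω f, ae_restrict_mem measurableSet_Ioc] with x h1 hx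
  have hf : Integrable (fun t => ‖f t‖) (intervalMeasure T) :=
    ((Lp.memLp f).integrable (by norm_num)).norm
  have hb (t : ℝ) : ‖κ (x, t) (f t)‖ ≤ C * (Ioc 0 x).indicator (fun t => ‖f t‖) t := by
    by_cases ht : t ∈ Ioc 0 x
    · rw [indicator_of_mem ht]
      exact (ContinuousLinearMap.le_opNorm _ _).trans
        (mul_le_mul_of_nonneg_right (hC _) (norm_nonneg _))
    · rw [hκ.eq_zero (x, t) fun h => ht ⟨h.1, h.2.1⟩, indicator_of_notMem ht]
      simp
  rw [h1]
  refine (norm_integral_le_of_norm_le ((hf.indicator measurableSet_Ioc).const_mul C)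
    (.of_forall hb)).trans_eq ?_
  rw [integral_const_mul, integral_indicator measurableSet_Ioc,
    Measure.restrict_restrict measurableSet_Ioc, inter_eq_left.2 (Ioc_subset_Ioc_right hx.2)]

/-- The first application turns the `L¹` norm of `f` into a pointwise bound; each further one
integrates the monomial once more. Hence the offset between power and factorial. -/
lemma ae_norm_op_pow_le (hω : IsWeight T ω) (hκ : IsDominatedKernel T ω κ) {C : ℝ} (hC0 : 0 ≤ C)
    (hC : ∀ p, ‖κ p‖ ≤ C) (f : L2 r T) (n : ℕ) :
    ∀ᵐ x ∂(intervalMeasure T), ‖(hκ.op hω ^ (n + 1)) f x‖ ≤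
      C ^ (n + 1) * (∫ t, ‖f t‖ ∂(intervalMeasure T)) * (x ^ n / n.factorial) := by
  induction n with
  | zero =>
    filter_upwards [hκ.ae_norm_op_le hω hC f, ae_restrict_mem measurableSet_Ioc] with x h1 hx
    rw [zero_add, pow_one, pow_one, pow_zero, Nat.factorial_zero, Nat.cast_one, div_one, mul_one]
    refine h1.trans (mul_le_mul_of_nonneg_left ?_ hC0)
    exact setIntegral_mono_set ((Lp.memLp f).integrable (by norm_num)).norm
      (.of_forall fun t => norm_nonneg _) (Ioc_subset_Ioc_right hx.2).eventuallyLE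
  | succ n ih =>
    rw [pow_succ' _ (n + 1)]
    filter_upwards [hκ.ae_norm_op_le hω hC ((hκ.op hω ^ (n + 1)) f),
      ae_restrict_mem measurableSet_Ioc] with x h1 hx
    change ‖hκ.op hω ((hκ.op hω ^ (n + 1)) f) x‖ ≤ _
    have h2 : ∫ t in Ioc 0 x, ‖(hκ.op hω ^ (n + 1)) f t‖ ≤ ∫ t in Ioc 0 x,
        C ^ (n + 1) * (∫ t, ‖f t‖ ∂(intervalMeasure T)) * (t ^ n / n.factorial) := by
      have hle : volume.restrict (Ioc 0 x) ≤ intervalMeasure T :=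
        Measure.restrict_mono (Ioc_subset_Ioc_right hx.2) le_rfl
      refine setIntegral_mono_ae_restrict ?_ ?_ (ae_mono hle ih)
      · exact ((Lp.memLp ((hκ.op hω ^ (n + 1)) f)).integrable (by norm_num)).norm.mono_measure hle
      · exact ContinuousOn.integrableOn_Icc (by fun_prop) |>.mono_set Ioc_subset_Icc_self
    refine h1.trans ((mul_le_mul_of_nonneg_left h2 hC0).trans_eq ?_)
    rw [integral_const_mul, integral_div, ← intervalIntegral.integral_of_le hx.1.le,
      integral_pow, Nat.factorial_succ]
    push_cast
    have : (n.factorial : ℝ) ≠ 0 := by positivity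
    have : (n + 1 : ℝ) ≠ 0 := by positivity
    field_simp
    simp
    ring

lemma tendsto_norm_op_pow (hω : IsWeight T ω) (hκ : IsDominatedKernel T ω κ) {C : ℝ}
    (hC : ∀ p, ‖κ p‖ ≤ C) :
    Filter.Tendsto (fun n : ℕ => ‖hκ.op hω ^ (n + 1)‖) Filter.atTop (nhds 0) := by
  have hC0 : 0 ≤ C := (norm_nonneg _).trans (hC 0)
  -- The norm of the embedding of `L²` in `L¹` on a finite measure space.
  obtain ⟨K, hK0, hK⟩ : ∃ K, 0 ≤ K ∧
      ∀ f : L2 r T, ∫ t, ‖f t‖ ∂(intervalMeasure T) ≤ K * ‖f‖ := by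
    refine ⟨((intervalMeasure T univ) ^ (1 / (1 : ℝ≥0∞).toReal - 1 / (2 : ℝ≥0∞).toReal)).toReal,
      ENNReal.toReal_nonneg, fun f => ?_⟩
    rw [integral_norm_eq_lintegral_enorm (Lp.aestronglyMeasurable f),
      ← eLpNorm_one_eq_lintegral_enorm, Lp.norm_def, mul_comm, ← ENNReal.toReal_mul]
    refine ENNReal.toReal_mono (ENNReal.mul_ne_top (Lp.memLp f).2.ne ?_)
      (eLpNorm_le_eLpNorm_mul_rpow_measure_univ (by norm_num) (Lp.aestronglyMeasurable f))
    exact ENNReal.rpow_ne_top_of_nonneg (by norm_num) (measure_ne_top _ _)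
  set S : ℝ := (measureUnivNNReal (intervalMeasure T) : ℝ) ^ (2 : ℝ≥0∞).toReal⁻¹
  have hbound (n : ℕ) : ‖hκ.op hω ^ (n + 1)‖ ≤
      S * C * K * ((C * |T|) ^ n / n.factorial) := by
    refine ContinuousLinearMap.opNorm_le_bound _ (by positivity) fun f => ?_
    have h : ∀ᵐ x ∂(intervalMeasure T), ‖(hκ.op hω ^ (n + 1)) f x‖ ≤
        C ^ (n + 1) * (K * ‖f‖) * (|T| ^ n / n.factorial) := by
      filter_upwards [hκ.ae_norm_op_pow_le hω hC0 hC f n, ae_restrict_mem measurableSet_Ioc]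
        with x h1 hx
      refine h1.trans ?_
      have hxT : x ^ n ≤ |T| ^ n := pow_le_pow_left₀ hx.1.le (hx.2.trans (le_abs_self T)) n
      have h0 : 0 ≤ x := hx.1.le
      gcongr
      exact hK f
    refine (Lp.norm_le_of_ae_bound (by positivity) h).trans_eq ?_
    rw [mul_pow]
    ring
  refine squeeze_zero (fun n => norm_nonneg _) hbound ?_
  have := (FloorSemiring.tendsto_pow_div_factorial_atTop (C * |T|)).const_mul (S * C * K)
  rwa [mul_zero] at this

/-- Some power of the operator has norm below one, so `1 - (-V)^(n+1)` is invertible. It is a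
geometric sum times `1 + V`, and the factors commute, so both are invertible. -/
lemma isUnit_one_add_op (hω : IsWeight T ω) (hκ : IsDominatedKernel T ω κ) {C : ℝ}
    (hC : ∀ p, ‖κ p‖ ≤ C) : IsUnit (1 + hκ.op hω) := by
  obtain ⟨n, hn⟩ := ((hκ.tendsto_norm_op_pow hω hC).eventually_lt_const zero_lt_one).exists
  set V := hκ.op hω
  have hu : IsUnit (1 - (-V) ^ (n + 1)) := by
    refine (Units.oneSub _ ?_).isUnit
    rw [neg_pow]
    refine lt_of_le_of_lt ?_ hn
    rcases neg_one_pow_eq_or (L2 r T →L[ℂ] L2 r T) (n + 1) with h | h <;> simp [h]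
  have h1 : 1 - (-V) ^ (n + 1) = (∑ i ∈ Finset.range (n + 1), (-V) ^ i) * (1 + V) := by
    have := geom_sum_mul_neg (-V) (n + 1)
    rw [← this, sub_neg_eq_add]
  rw [h1] at hu
  refine ((Commute.isUnit_mul_iff ?_).1 hu).2
  exact Commute.sum_left _ _ _ fun i _ =>
    (Commute.one_right _).add_right ((Commute.refl V).neg_left.pow_left i)

end IsDominatedKernel

end DiracSim

end

/-! ### The similarity of `K` and `A` -/

theorem proposition3p1 (m₁ m₂ : ℕ) (T : ℝ) (hT : 0 < T)
    (v : ℝ → Matrix (Fin m₁) (Fin m₂) ℂ) (hv : DiracSim.SquareSummable T v)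
    (u : ℝ → Matrix (Fin m₁ ⊕ Fin m₂) (Fin m₁ ⊕ Fin m₂) ℂ)
    (hu : DiracSim.IsFundamentalSolution T v 0 u) :
    ∃ (E : DiracSim.L2 m₂ T ≃L[ℂ] DiracSim.L2 m₂ T)
      (N : ℝ → ℝ → Matrix (Fin m₂) (Fin m₂) ℂ) (hN : DiracSim.IsHilbertSchmidtKernel T N),
      -- `K = E A E⁻¹`
      DiracSim.diracOp hT hu =
        (E : DiracSim.L2 m₂ T →L[ℂ] DiracSim.L2 m₂ T) ∘L DiracSim.integrationOp m₂ T ∘L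
          (E.symm : DiracSim.L2 m₂ T →L[ℂ] DiracSim.L2 m₂ T) ∧
      -- `E = I + ∫₀ˣ N(x, t) · dt`
      (E : DiracSim.L2 m₂ T →L[ℂ] DiracSim.L2 m₂ T) =
        ContinuousLinearMap.id ℂ (DiracSim.L2 m₂ T) + DiracSim.volterraOp N hN ∧
      -- `E⁻¹ γ₂ ≡ I_{m₂}`, where `E⁻¹` acts columnwise
      (∀ c : EuclideanSpace ℂ (Fin m₂),
        E.symm ((hu.memLp_gammaTwoVec hT c).toLp (DiracSim.gammaTwoVec u c))
          =ᵐ[DiracSim.intervalMeasure T] fun _ => c) ∧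
      -- `E` and `E⁻¹` preserve the functions with a square-summable derivative
      (∀ F : DiracSim.L2 m₂ T,
        DiracSim.HasSquareSummableDeriv F → DiracSim.HasSquareSummableDeriv (E F)) ∧
      (∀ F : DiracSim.L2 m₂ T,
        DiracSim.HasSquareSummableDeriv F → DiracSim.HasSquareSummableDeriv (E.symm F)) := by
  open MeasureTheory DiracSim in
  obtain ⟨w, hw, hvw⟩ := hv.exists_isRegularPotential
  have huw := hu.congr_ae hvw
  have hω := hw.isWeight
  have hq := hw.isDominatedKernel
  obtain ⟨κ, hκ, ⟨C, hC⟩, hfix⟩ := hq.exists_eq_transformStep hω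
  have hqκ := hq.comp hω hκ
  have hM := hq.add hqκ
  obtain ⟨e, he⟩ := hκ.isUnit_one_add_op hω hC
  set A := integrationOp m₂ T
  set K := diracOp hT hu
  set Q := hw.op
  set I := Complex.I
  -- The integrand `M = q + q κ` of the fixed-point equation is the kernel of `Q E`.
  have hMQ : hM.op hω = Q * e.1 := by
    rw [he, mul_add, mul_one, IsDominatedKernel.op_add hω hq hqκ,
      IsDominatedKernel.op_comp hω hq hκ]
    rfl
  -- the relation between `K` and `A`
  have hKA : K * (1 - I • (Q * A)) = A := huw.diracOp_mul_one_sub hT hw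
  have hEA : e.1 * A = A * (e.1 + I • (Q * e.1 * A)) := by
    have h := hM.op_comp_integrationOp_sub hω hκ hfix
    rw [hMQ] at h
    rw [he] at h ⊢
    rw [add_mul, one_mul, mul_add, mul_add, mul_one, mul_smul_comm, add_assoc]
    congr 1
    rw [← sub_eq_iff_eq_add', h]
    simp only [mul_assoc]
    rfl
  have hKE : K * e.1 = e.1 * A := by
    have h1 : e.1 * A = K * ((1 - I • (Q * A)) * (e.1 + I • (Q * e.1 * A))) := by
      rw [hEA, ← mul_assoc, hKA]
    -- The correction to `E` contains the defect of `hEA` and hence vanishes.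
    have h2 : (1 - I • (Q * A)) * (e.1 + I • (Q * e.1 * A)) =
        e.1 + I • (Q * (e.1 * A - A * (e.1 + I • (Q * e.1 * A)))) := by
      simp only [sub_mul, mul_add, mul_sub, one_mul, smul_mul_assoc, mul_smul_comm, smul_add,
        smul_sub, mul_assoc]
      abel
    rw [h1, h2, ← hEA, sub_self, mul_zero, smul_zero, add_zero]
  have hconst (c : EuclideanSpace ℂ (Fin m₂)) : e.1 (Lp.const 2 (intervalMeasure T) c) =
      Lp.const 2 (intervalMeasure T) c +
        A (I • Q (e.1 (Lp.const 2 (intervalMeasure T) c))) := by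
    have h := hM.op_const_eq hω hκ hfix c
    rw [hMQ] at h
    conv_lhs => rw [he]
    rw [add_apply, h, map_smul]
    rfl
  have hγ (c : EuclideanSpace ℂ (Fin m₂)) : e.1 (Lp.const 2 (intervalMeasure T) c) =
      (hu.memLp_gammaTwoVec hT c).toLp (gammaTwoVec u c) := by
    set G := (hu.memLp_gammaTwoVec hT c).toLp (gammaTwoVec u c)
    set F := e.1 (Lp.const 2 (intervalMeasure T) c)
    have hG : G = Lp.const 2 (intervalMeasure T) c + I • A (Q G) := huw.gammaTwoVec_eq hT hw c
    have hF : F = Lp.const 2 (intervalMeasure T) c + I • A (Q F) := by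
      rw [← map_smul]
      exact hconst c
    -- Uniqueness: for `D = i A Q D`, the relation between `K` and `A` gives `A Q D = K Q (D - i A Q
    -- D) = 0`, so `D = 0`.
    have hd : F - G = I • A (Q (F - G)) := by
      conv_lhs => rw [hF, hG]
      rw [add_sub_add_left_eq_sub, ← smul_sub, ← map_sub, ← map_sub]
    have hd' : A (Q (F - G)) = K (Q (F - G) - I • Q (A (Q (F - G)))) := by
      conv_lhs => rw [← hKA]
      rfl
    have hd'' (D : L2 m₂ T) : Q D - I • Q (A (Q D)) = Q (D - I • A (Q D)) := by
      rw [map_sub, map_smul]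
    rw [hd'', sub_eq_zero.2 hd, map_zero, map_zero] at hd'
    rw [hd', smul_zero] at hd
    exact sub_eq_zero.1 hd
  have hinv (f) : (e⁻¹).1 (e.1 f) = f := congrArg (fun L : L2 m₂ T →L[ℂ] L2 m₂ T => L f) e.inv_mul
  -- From `A = K (1 - i Q A)` and `K = E A E⁻¹`: `E⁻¹` maps the range of `A` into itself.
  have hinvA : (e⁻¹).1 * A = A * ((e⁻¹).1 * (1 - I • (Q * A))) := by
    have h1 : K = e.1 * A * (e⁻¹).1 := by rw [← hKE, mul_assoc, e.mul_inv, mul_one]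
    calc (e⁻¹).1 * A = (e⁻¹).1 * (K * (1 - I • (Q * A))) := by rw [hKA]
      _ = (e⁻¹).1 * e.1 * (A * ((e⁻¹).1 * (1 - I • (Q * A)))) := by
        rw [h1]
        simp only [mul_assoc]
      _ = _ := by rw [e.inv_mul, one_mul]
  refine ⟨ContinuousLinearEquiv.unitsEquiv ℂ _ e, matrixKernel κ, hκ.isHilbertSchmidtKernel hω,
    ?_, he, fun c => ?_, fun F hF => ?_, fun F hF => ?_⟩
  · change K = e.1 * (A * (e⁻¹).1)
    rw [← mul_assoc, ← hKE, mul_assoc, e.mul_inv, mul_one]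
  · change (e⁻¹).1 _ =ᵐ[_] _
    rw [← hγ, hinv]
    exact Lp.coeFn_const (μ := intervalMeasure T) (p := 2) c
  · obtain ⟨c, g, rfl⟩ := hF.exists_eq_const_add hT
    change HasSquareSummableDeriv (e.1 _)
    have hg : e.1 (A g) = A ((e.1 + I • (Q * e.1 * A)) g) :=
      congrArg (fun L : L2 m₂ T →L[ℂ] L2 m₂ T => L g) hEA
    rw [map_add, hconst, hg, add_assoc, ← map_add]
    exact hasSquareSummableDeriv_const_add hT c _
  · obtain ⟨c, g, rfl⟩ := hF.exists_eq_const_add hT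
    change HasSquareSummableDeriv ((e⁻¹).1 _)
    have hg (g) : (e⁻¹).1 (A g) = A (((e⁻¹).1 * (1 - I • (Q * A))) g) :=
      congrArg (fun L : L2 m₂ T →L[ℂ] L2 m₂ T => L g) hinvA
    -- Applying `E⁻¹` to `E c = c + A(…)` shows that `E⁻¹ c` differs from `c` by an element of the
    -- range of `A`.
    have hc := congrArg (e⁻¹).1 (hconst c)
    rw [hinv, map_add, hg] at hc
    rw [map_add, hg, ← sub_eq_iff_eq_add.2 hc, sub_add_eq_add_sub, add_sub_assoc, ← map_sub]
    exact hasSquareSummableDeriv_const_add hT c _
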